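/- Let $K$ be a field. A special poset is a finite set with a partial order $\leq_1$ and a total order $\leq_2$, up to isomorphism; we identify its elements with $1,\dots,n$, in increasing order for $\leq_2$. Let $\mathbf{h}_{\mathcal{SP}}$ be the Hopf algebra with basis the special posets; the product $PQ$ is the disjoint union, with elements of $P$ and $Q$ incomparable for $\leq_1$ and $x\leq_2 y$ for $x\in P$, $y\in Q$; the coproduct is $\Delta(P)=\sum_I (P\setminus I)\otimes I$, over the subsets $I$ of $P$ that are upwards closed for $\leq_1$. Let $\langle P,Q\rangle$ be the number of bijections $f:P\to Q$ such that $i\leq_1 j\Rightarrow f(i)\leq_2 f(j)$ and $f(i)\leq_1 f(j)\Rightarrow i\leq_2 j$; this extends bilinearly to the Hopf pairing. A heap-ordered forest is a special poset such that $x\leq_1 y$ implies $x\leq_2 y$ and the Hasse graph of $\leq_1$ is a forest whose roots are the minimal elements (the elements $\leq_1$ a given one form a chain); these span a Hopf subalgebra $\mathbf{h}_{\mathcal{HOF}}$ of $\mathbf{h}_{\mathcal{SP}}$. Let $\mathbf{FQSym}$ have basis $\bigsqcup_n\mathfrak{S}_n$, with product $\sigma\tau=\sum_\epsilon(\sigma\otimes\tau)\circ\epsilon$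 over the shuffles $\epsilon$ (the permutations whose inverse is increasing on the first $k$ and on the last $l$ elements, for $\sigma\in\mathfrak{S}_k$, $\tau\in\mathfrak{S}_l$) and coproduct given by cutting the word of a permutation in two in all ways and standardizing the pieces. Let $\Theta:\mathbf{h}_{\mathcal{SP}}\to\mathbf{FQSym}$ be the linear map with $\Theta(P)=\sum\sigma$ over the permutations $\sigma$ such that $i<_1 j$ in $P$ implies $\sigma^{-1}(i)<\sigma^{-1}(j)$. For a special poset $P$, let $R_P$ be the set of edges of the Hasse graph of $\leq_1$ (pairs $(i,j)$, $i\neq j$, with $\{k: i\leq_1 k\leq_1 j\}=\{i,j\}$). Consider two transformations of $P$, where each new special poset has the same total order and a first order generated by the indicated set: 1. if $i<j$ and $(j,i)\in R_P$, replace $P$ by $P_1-P_2$, with $P_1$, $P_2$ given by $R_P\setminus\{(j,i)\}$ and $(R_P\setminus\{(j,i)\})\cup\{(i,j)\}$; 2. if $i<j<k$ and $(i,k),(j,k)\in R_P$, replace $P$ by $P_3-P_4+P_5$, with $P_3$, $P_4$, $P_5$ given by $R_P\setminus\{(j,k)\}$, $(R_P\setminus\{(j,k)\})\cup\{(i,j)\}$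 and $(R_P\setminus\{(j,k),(i,k)\})\cup\{(i,j),(j,k)\}$. Theorem 25. Applying these transformations repeatedly, in any order, to the special posets appearing in an element $x$ of $\mathbf{h}_{\mathcal{SP}}$ always terminates, and stops exactly when a linear combination of heap-ordered forests is reached. This linear combination $\Upsilon(x)$ does not depend on the way the transformations are performed (even if several occurrences of the same special poset are transformed differently). The map $\Upsilon:\mathbf{h}_{\mathcal{SP}}\to\mathbf{h}_{\mathcal{HOF}}$ is a Hopf algebra morphism, and $\Theta\circ\Upsilon=\Theta$. The restriction $\Theta_{\mid\mathbf{h}_{\mathcal{HOF}}}:\mathbf{h}_{\mathcal{HOF}}\to\mathbf{FQSym}$ is an isomorphism of Hopf algebras, and $\Upsilon_{\mid\mathbf{h}_{\mathcal{HOF}}}=\mathrm{Id}$. Moreover $\langle\Upsilon(x),\Upsilon(y)\rangle=\langle x,y\rangle$ for all $x,y\in\mathbf{h}_{\mathcal{SP}}$. -/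

import Mathlib

namespace SpecialPosets

open scoped TensorProduct

/-- A special poset, i.e. a finite set with a partial order (the first order) and a total order
(the second order), up to isomorphism. The underlying set is identified with `Fin card` through
the unique increasing bijection for the second order; `le` is the first order. -/
structure SpecialPoset where
  /-- the number of elements -/
  card : ℕ
  /-- the first order; the second order is the usual total order of `Fin card` -/
  le : Fin card → Fin card → Prop
  isPartialOrder : IsPartialOrder (Fin card) le

namespace SpecialPoset

attribute [instance] SpecialPoset.isPartialOrder

/-- The special poset `(α, r, ≤)`, where `≤` is the given total order of `α`. -/
def std (α : Type) [Fintype α] [LinearOrder α] (r : α → α → Prop) [IsPartialOrder α r] :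
    SpecialPoset where
  card := Fintype.card α
  le i j := r (monoEquivOfFin α rfl i) (monoEquivOfFin α rfl j)
  isPartialOrder :=
    { refl := fun _ => refl_of r _
      trans := fun _ _ _ h h' => trans_of r h h'
      antisymm := fun _ _ h h' => (monoEquivOfFin α rfl).injective (antisymm_of r h h') }

theorem ext_of_iso {P Q : SpecialPoset} (f : Fin P.card ≃o Fin Q.card)
    (h : ∀ i j, P.le i j ↔ Q.le (f i) (f j)) : P = Q := by
  obtain ⟨n, le, hle⟩ := P
  obtain ⟨m, le', hle'⟩ := Q
  have hc : n = m := by simpa using Fintype.card_congr f.toEquiv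
  subst hc
  have : f = OrderIso.refl _ := Subsingleton.elim _ _
  subst this
  have : le = le' := by
    funext i j
    exact propext (h i j)
  subst this
  rfl

theorem eq_std {P : SpecialPoset} {β : Type} [Fintype β] [LinearOrder β]
    {s : β → β → Prop} [IsPartialOrder β s]
    (f : Fin P.card → β) (hf : StrictMono f) (hs : Function.Surjective f)
    (h : ∀ a b, P.le a b ↔ s (f a) (f b)) : P = std β s := by
  refine ext_of_iso ((hf.orderIsoOfSurjective f hs).trans (monoEquivOfFin β rfl).symm) ?_
  intro i j
  rw [h]
  change _ ↔ s (monoEquivOfFin β rfl ((monoEquivOfFin β rfl).symm (f i)))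
    (monoEquivOfFin β rfl ((monoEquivOfFin β rfl).symm (f j)))
  simp

theorem std_congr {α β : Type} [Fintype α] [LinearOrder α] [Fintype β] [LinearOrder β]
    {r : α → α → Prop} {s : β → β → Prop} [IsPartialOrder α r] [IsPartialOrder β s]
    (f : α → β) (hf : StrictMono f) (hs : Function.Surjective f)
    (h : ∀ a b, r a b ↔ s (f a) (f b)) : std α r = std β s :=
  eq_std (f ∘ monoEquivOfFin α rfl) (hf.comp (monoEquivOfFin α rfl).strictMono)
    (hs.comp (monoEquivOfFin α rfl).surjective) fun _ _ => h _ _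

/-- The product `PQ`: the disjoint union of `P` and `Q`, where for the first order no element of
`P` is comparable with an element of `Q`, and for the second order all elements of `P` are
smaller than all elements of `Q`. -/
instance : Mul SpecialPoset where
  mul P Q :=
    { card := P.card + Q.card
      le := fun i j => Sum.LiftRel P.le Q.le (finSumFinEquiv.symm i) (finSumFinEquiv.symm j)
      isPartialOrder :=
        { refl := fun _ => refl_of (Sum.LiftRel P.le Q.le) _
          trans := fun _ _ _ h h' => trans_of (Sum.LiftRel P.le Q.le) h h'
          antisymm := fun _ _ h h' =>
            finSumFinEquiv.symm.injective (antisymm_of (Sum.LiftRel P.le Q.le) h h') } }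

/-- The empty special poset. -/
instance : One SpecialPoset where
  one :=
    { card := 0
      le := fun i j => i = j
      isPartialOrder :=
        { refl := fun _ => rfl
          trans := fun _ _ _ h h' => h.trans h'
          antisymm := fun _ _ h _ => h } }

theorem card_mul (P Q : SpecialPoset) : (P * Q).card = P.card + Q.card := rfl

theorem card_one : (1 : SpecialPoset).card = 0 := rfl

/-- The inclusion of `P` in `PQ`. -/
def inl (P Q : SpecialPoset) (i : Fin P.card) : Fin (P * Q).card := Fin.castAdd Q.card i

/-- The inclusion of `Q` in `PQ`. -/
def inr (P Q : SpecialPoset) (i : Fin Q.card) : Fin (P * Q).card := Fin.natAdd P.card i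

theorem mul_cases (P Q : SpecialPoset) (x : Fin (P * Q).card) :
    (∃ i, x = inl P Q i) ∨ ∃ j, x = inr P Q j := by
  refine Fin.addCases (m := P.card) (n := Q.card) (fun i => ?_) (fun i => ?_) x
  · exact Or.inl ⟨i, rfl⟩
  · exact Or.inr ⟨i, rfl⟩

section
variable {P Q : SpecialPoset}

theorem mul_le_iff (i j : Fin (P.card + Q.card)) : (P * Q).le i j ↔
    Sum.LiftRel P.le Q.le (finSumFinEquiv.symm i) (finSumFinEquiv.symm j) := Iff.rfl

@[simp] theorem inl_le_inl (i j) : (P * Q).le (inl P Q i) (inl P Q j) ↔ P.le i j := by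
  simp [inl, mul_le_iff]

@[simp] theorem inr_le_inr (i j) : (P * Q).le (inr P Q i) (inr P Q j) ↔ Q.le i j := by
  simp [inr, mul_le_iff]

@[simp] theorem inl_le_inr (i j) : ¬ (P * Q).le (inl P Q i) (inr P Q j) := by
  simp [inl, inr, mul_le_iff]

@[simp] theorem inr_le_inl (i j) : ¬ (P * Q).le (inr P Q i) (inl P Q j) := by
  simp [inl, inr, mul_le_iff]

@[simp] theorem inl_lt_inl (i j) : inl P Q i < inl P Q j ↔ i < j := Iff.rfl

@[simp] theorem inr_lt_inr (i j) : inr P Q i < inr P Q j ↔ i < j := by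
  exact Fin.natAdd_lt_natAdd_iff P.card

@[simp] theorem inl_lt_inr (i j) : inl P Q i < inr P Q j := by
  simp only [inl, inr, Fin.lt_def, Fin.val_castAdd, Fin.val_natAdd]
  omega

@[simp] theorem inr_lt_inl (i j) : ¬ inr P Q i < inl P Q j := (inl_lt_inr j i).asymm

@[simp] theorem inl_inj (i j) : inl P Q i = inl P Q j ↔ i = j :=
  (Fin.castAdd_injective P.card Q.card).eq_iff

@[simp] theorem inr_inj (i j) : inr P Q i = inr P Q j ↔ i = j :=
  (Fin.natAdd_injective Q.card P.card).eq_iff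

@[simp] theorem inl_ne_inr (i j) : inl P Q i ≠ inr P Q j := (inl_lt_inr i j).ne

@[simp] theorem inr_ne_inl (i j) : inr P Q i ≠ inl P Q j := (inl_lt_inr j i).ne'

end

/-- A criterion for recognizing a product. -/
theorem mul_eq_std {P Q : SpecialPoset} {β : Type} [Fintype β] [LinearOrder β]
    {s : β → β → Prop} [IsPartialOrder β s] (f : Fin P.card → β) (g : Fin Q.card → β)
    (hf : StrictMono f) (hg : StrictMono g) (hfg : ∀ i j, f i < g j)
    (hs : ∀ b, (∃ i, f i = b) ∨ ∃ j, g j = b) (h1 : ∀ i j, P.le i j ↔ s (f i) (f j))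
    (h2 : ∀ i j, Q.le i j ↔ s (g i) (g j)) (h3 : ∀ i j, ¬ s (f i) (g j))
    (h4 : ∀ i j, ¬ s (g i) (f j)) : P * Q = std β s := by
  let F : Fin (P * Q).card → β := Fin.addCases (m := P.card) (n := Q.card) f g
  have hF1 : ∀ i, F (inl P Q i) = f i := fun i => Fin.addCases_left i
  have hF2 : ∀ i, F (inr P Q i) = g i := fun i => Fin.addCases_right i
  refine eq_std F ?_ ?_ ?_
  · intro x y hxy
    rcases mul_cases P Q x with ⟨i, rfl⟩ | ⟨i, rfl⟩ <;>
      rcases mul_cases P Q y with ⟨j, rfl⟩ | ⟨j, rfl⟩ <;> simp only [hF1, hF2]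
    · exact hf (by simpa using hxy)
    · exact hfg _ _
    · simp at hxy
    · exact hg (by simpa using hxy)
  · intro b
    rcases hs b with ⟨i, rfl⟩ | ⟨i, rfl⟩
    · exact ⟨_, hF1 i⟩
    · exact ⟨_, hF2 i⟩
  · intro x y
    rcases mul_cases P Q x with ⟨i, rfl⟩ | ⟨i, rfl⟩ <;>
      rcases mul_cases P Q y with ⟨j, rfl⟩ | ⟨j, rfl⟩ <;> simp only [hF1, hF2, inl_le_inl, inr_le_inr, inl_le_inr, inr_le_inl, h1, h2, h3, h4]

theorem eq_std_self (P : SpecialPoset) : P = std (Fin P.card) P.le :=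
  eq_std id strictMono_id Function.surjective_id fun _ _ => Iff.rfl

instance : Monoid SpecialPoset where
  mul_assoc P Q R := by
    let f : Fin ((P * Q) * R).card ≃o Fin (P * (Q * R)).card :=
      Fin.castOrderIso (Nat.add_assoc P.card Q.card R.card)
    have h1 : ∀ i, f (inl (P * Q) R (inl P Q i)) = inl P (Q * R) i := fun i => Fin.ext rfl
    have h2 : ∀ i, f (inl (P * Q) R (inr P Q i)) = inr P (Q * R) (inl Q R i) :=
      fun i => Fin.ext rfl
    have h3 : ∀ i, f (inr (P * Q) R i) = inr P (Q * R) (inr Q R i) :=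
      fun i => Fin.ext (Nat.add_assoc P.card Q.card i)
    refine ext_of_iso f ?_
    intro x y
    rcases mul_cases _ _ x with ⟨x, rfl⟩ | ⟨x, rfl⟩ <;>
      rcases mul_cases _ _ y with ⟨y, rfl⟩ | ⟨y, rfl⟩ <;>
      (try rcases mul_cases _ _ x with ⟨x, rfl⟩ | ⟨x, rfl⟩) <;>
      (try rcases mul_cases _ _ y with ⟨y, rfl⟩ | ⟨y, rfl⟩) <;> simp [h1, h2, h3]
  one_mul P := by
    refine Eq.trans ?_ (eq_std_self _).symm
    exact mul_eq_std (fun i => i.elim0) id (fun i => i.elim0) strictMono_id (fun i => i.elim0)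
      (fun b => Or.inr ⟨b, rfl⟩) (fun i => i.elim0) (fun _ _ => Iff.rfl) (fun i => i.elim0)
      (fun _ j => j.elim0)
  mul_one P := by
    refine Eq.trans ?_ (eq_std_self _).symm
    exact mul_eq_std id (fun i => i.elim0) strictMono_id (fun i => i.elim0) (fun _ j => j.elim0)
      (fun b => Or.inl ⟨b, rfl⟩) (fun _ _ => Iff.rfl) (fun i => i.elim0) (fun _ j => j.elim0)
      (fun i => i.elim0)

instance {α : Type} (r : α → α → Prop) [IsPartialOrder α r] (s : Finset α) :
    IsPartialOrder {x // x ∈ s} (fun x y => r x y) where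
  refl x := refl_of r x.1
  trans _ _ _ h h' := trans_of r h h'
  antisymm _ _ h h' := Subtype.ext (antisymm_of r h h')

/-- The subset `s` of `P`, with the restrictions of both orders. -/
def restrict (P : SpecialPoset) (s : Finset (Fin P.card)) : SpecialPoset :=
  std {x // x ∈ s} (fun x y => P.le x y)

open Classical in
/-- The ideals of `P`: the subsets that are upwards closed for the first order. -/
noncomputable def ideals (P : SpecialPoset) : Finset (Finset (Fin P.card)) :=
  Finset.univ.filter fun I => ∀ x ∈ I, ∀ y, P.le x y → y ∈ I

/-- `P` is heap-ordered: the second order extends the first. -/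
def IsHeapOrdered (P : SpecialPoset) : Prop := ∀ x y, P.le x y → x ≤ y

/-- `P` is an ordered forest: the Hasse graph of the first order, oriented upwards, is a
forest oriented from its roots to its leaves. In other words, the elements below a given one form
a chain. -/
def IsForest (P : SpecialPoset) : Prop := ∀ x y z, P.le x z → P.le y z → P.le x y ∨ P.le y x

/-- The set of the edges of the Hasse graph of the first order: the pairs `(i, j)` with `i ≠ j`
such that the interval `[i, j]` is `{i, j}`. -/
def hasse (P : SpecialPoset) : Set (Fin P.card × Fin P.card) :=
  {p | p.1 ≠ p.2 ∧ ∀ k, P.le p.1 k ∧ P.le k p.2 ↔ k = p.1 ∨ k = p.2}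

/-- The reflexive and transitive relation generated by a set of pairs. -/
def Path {n : ℕ} (R : Set (Fin n × Fin n)) : Fin n → Fin n → Prop :=
  Relation.ReflTransGen fun x y => (x, y) ∈ R

/-- A set of pairs generates a partial order. -/
def Acyclic {n : ℕ} (R : Set (Fin n × Fin n)) : Prop :=
  ∀ x y, Path R x y → Path R y x → x = y

/-- The special poset on `Fin n` whose first order is generated by the set `R`; its Hasse graph is
obtained from `R` by the elimination of the redundant pairs. -/
def generate {n : ℕ} (R : Set (Fin n × Fin n)) (h : Acyclic R) : SpecialPoset where
  card := n
  le := Path R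
  isPartialOrder :=
    { refl := fun _ => Relation.ReflTransGen.refl
      trans := fun _ _ _ h1 h2 => Relation.ReflTransGen.trans h1 h2
      antisymm := h }

section
variable {P : SpecialPoset} {R : Set (Fin P.card × Fin P.card)}

theorem hasse_le {x y : Fin P.card} (h : (x, y) ∈ P.hasse) : P.le x y :=
  ((h.2 y).2 (Or.inr rfl)).1

theorem path_le (hR : R ⊆ P.hasse) {x y : Fin P.card} (h : Path R x y) : P.le x y := by
  induction h with
  | refl => exact refl_of P.le x
  | tail _ h ih => exact trans_of P.le ih (hasse_le (hR h))

theorem acyclic_of_subset (hR : R ⊆ P.hasse) : Acyclic R := fun _ _ h h' =>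
  antisymm_of P.le (path_le hR h) (path_le hR h')

theorem path_insert {a b x y : Fin P.card} (h : Path (insert (a, b) R) x y) :
    Path R x y ∨ Path R x a ∧ Path R b y := by
  induction h with
  | refl => exact Or.inl Relation.ReflTransGen.refl
  | tail _ h ih =>
    rcases h with h | h
    · obtain ⟨rfl, rfl⟩ := Prod.mk.inj h
      rcases ih with ih | ih
      · exact Or.inr ⟨ih, Relation.ReflTransGen.refl⟩
      · exact Or.inr ⟨ih.1, Relation.ReflTransGen.refl⟩
    · rcases ih with ih | ih
      · exact Or.inl (ih.tail h)
      · exact Or.inr ⟨ih.1, ih.2.tail h⟩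

theorem acyclic_insert (hR : R ⊆ P.hasse) {a b : Fin P.card} (hab : ¬ Path R b a) :
    Acyclic (insert (a, b) R) := by
  intro x y h h'
  rcases path_insert h with h | h <;> rcases path_insert h' with h' | h'
  · exact acyclic_of_subset hR x y h h'
  · exact absurd (h'.2.trans (h.trans h'.1)) hab
  · exact absurd (h.2.trans (h'.trans h.1)) hab
  · exact absurd (h.2.trans h'.1) hab

/-- Reversing an edge does not create a cycle. -/
theorem acyclic_reverse {i j : Fin P.card} (h : (j, i) ∈ P.hasse) :
    Acyclic (insert (i, j) (P.hasse \ {(j, i)})) := by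
  refine acyclic_insert Set.sdiff_subset fun hp => ?_
  rcases Relation.ReflTransGen.cases_head hp with hji | ⟨x, hx, hp⟩
  · exact h.1 hji
  · have hxi : P.le x i := path_le Set.sdiff_subset hp
    rcases (h.2 x).1 ⟨hasse_le hx.1, hxi⟩ with hh | hh
    · exact hx.1.1 hh.symm
    · exact hx.2 (by rw [hh]; rfl)

theorem not_le_of_hasse {i j k : Fin P.card} (hij : i < j) (hi : (i, k) ∈ P.hasse)
    (hj : (j, k) ∈ P.hasse) : ¬ P.le j i := fun hji => by
  rcases (hj.2 i).1 ⟨hji, hasse_le hi⟩ with hh | hh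
  · exact hij.ne hh
  · exact hi.1 hh

theorem acyclic_graft {i j k : Fin P.card} (hij : i < j) (hi : (i, k) ∈ P.hasse)
    (hj : (j, k) ∈ P.hasse) : Acyclic (insert (i, j) (P.hasse \ {(j, k)})) :=
  acyclic_insert Set.sdiff_subset fun hp =>
    not_le_of_hasse hij hi hj (path_le Set.sdiff_subset hp)

theorem acyclic_chain {i j k : Fin P.card} (hij : i < j) (hi : (i, k) ∈ P.hasse)
    (hj : (j, k) ∈ P.hasse) :
    Acyclic ((P.hasse \ {(j, k), (i, k)}) ∪ {(i, j), (j, k)}) := by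
  have hs : insert (j, k) (P.hasse \ {(j, k), (i, k)}) ⊆ P.hasse :=
    Set.insert_subset hj Set.sdiff_subset
  have he : (P.hasse \ {(j, k), (i, k)}) ∪ {(i, j), (j, k)} =
      insert (i, j) (insert (j, k) (P.hasse \ {(j, k), (i, k)})) := by
    rw [Set.union_comm, Set.insert_union, Set.singleton_union]
  rw [he]
  exact acyclic_insert hs fun hp => not_le_of_hasse hij hi hj (path_le hs hp)

end

theorem mem_ideals {P : SpecialPoset} {I : Finset (Fin P.card)} :
    I ∈ P.ideals ↔ ∀ x ∈ I, ∀ y, P.le x y → y ∈ I := by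
  simp [ideals]

theorem card_restrict (P : SpecialPoset) (s : Finset (Fin P.card)) :
    (P.restrict s).card = s.card := by
  simp [restrict, std]

/-- The inclusion of a subset of `P` in `P`. -/
def incl (P : SpecialPoset) (s : Finset (Fin P.card)) (i : Fin (P.restrict s).card) :
    Fin P.card :=
  (monoEquivOfFin {x // x ∈ s} rfl i).1

section
variable {P : SpecialPoset} {s : Finset (Fin P.card)}

theorem incl_mem (i) : incl P s i ∈ s := (monoEquivOfFin {x // x ∈ s} rfl i).2

theorem incl_strictMono : StrictMono (incl P s) := (monoEquivOfFin {x // x ∈ s} rfl).strictMono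

theorem exists_incl {x} (hx : x ∈ s) : ∃ i, incl P s i = x :=
  ⟨(monoEquivOfFin {x // x ∈ s} rfl).symm ⟨x, hx⟩, by simp [incl]⟩

theorem restrict_le_iff (i j) : (P.restrict s).le i j ↔ P.le (incl P s i) (incl P s j) := Iff.rfl

end

theorem restrict_congr {P Q : SpecialPoset} {s : Finset (Fin P.card)} {t : Finset (Fin Q.card)}
    (f : Fin P.card → Fin Q.card) (hf : ∀ a ∈ s, ∀ b ∈ s, a < b → f a < f b)
    (hst : s.image f = t)
    (h : ∀ a ∈ s, ∀ b ∈ s, (P.le a b ↔ Q.le (f a) (f b))) : P.restrict s = Q.restrict t := by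
  subst hst
  refine std_congr (fun x => ⟨f x.1, Finset.mem_image_of_mem f x.2⟩) ?_ ?_ ?_
  · intro x y hxy
    exact hf _ x.2 _ y.2 hxy
  · rintro ⟨y, hy⟩
    obtain ⟨x, hx, rfl⟩ := Finset.mem_image.1 hy
    exact ⟨⟨x, hx⟩, rfl⟩
  · intro x y
    exact h _ x.2 _ y.2

theorem restrict_univ (P : SpecialPoset) : P.restrict Finset.univ = P := by
  conv_rhs => rw [eq_std_self P]
  exact std_congr Subtype.val (fun _ _ h => h) (fun x => ⟨⟨x, Finset.mem_univ x⟩, rfl⟩)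
    fun _ _ => Iff.rfl

theorem eq_one_of_card {P : SpecialPoset} (h : P.card = 0) : P = 1 := by
  obtain ⟨n, le, hle⟩ := P
  simp only at h
  subst h
  refine ext_of_iso (OrderIso.refl _) fun i => i.elim0

theorem restrict_empty (P : SpecialPoset) : P.restrict ∅ = 1 :=
  eq_one_of_card (by simp [card_restrict])

theorem restrict_restrict (P : SpecialPoset) (s : Finset (Fin P.card))
    (t : Finset (Fin (P.restrict s).card)) :
    (P.restrict s).restrict t = P.restrict (t.image (incl P s)) :=
  restrict_congr (incl P s) (fun _ _ _ _ h => incl_strictMono h) rfl fun _ _ _ _ => Iff.rfl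

theorem restrict_mul (P Q : SpecialPoset) (s : Finset (Fin P.card)) (t : Finset (Fin Q.card)) :
    (P * Q).restrict (s.image (inl P Q) ∪ t.image (inr P Q)) = P.restrict s * Q.restrict t := by
  symm
  refine mul_eq_std
    (fun i => ⟨inl P Q (incl P s i), Finset.mem_union_left _
      (Finset.mem_image_of_mem _ (incl_mem i))⟩)
    (fun i => ⟨inr P Q (incl Q t i), Finset.mem_union_right _
      (Finset.mem_image_of_mem _ (incl_mem i))⟩) ?_ ?_ ?_ ?_ ?_ ?_ ?_ ?_
  · intro i j h
    simpa using incl_strictMono h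
  · intro i j h
    simpa using incl_strictMono h
  · intro i j
    simp
  · rintro ⟨b, hb⟩
    rcases Finset.mem_union.1 hb with h | h
    · obtain ⟨x, hx, rfl⟩ := Finset.mem_image.1 h
      obtain ⟨i, rfl⟩ := exists_incl hx
      exact Or.inl ⟨i, rfl⟩
    · obtain ⟨x, hx, rfl⟩ := Finset.mem_image.1 h
      obtain ⟨i, rfl⟩ := exists_incl hx
      exact Or.inr ⟨i, rfl⟩
  · intro i j
    simp [restrict_le_iff]
  · intro i j
    simp [restrict_le_iff]
  · intro i j
    simp
  · intro i j
    simp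

/-- The part of a subset of `PQ` in `P`. -/
def lpart (P Q : SpecialPoset) (s : Finset (Fin (P * Q).card)) : Finset (Fin P.card) :=
  Finset.univ.filter fun i => inl P Q i ∈ s

/-- The part of a subset of `PQ` in `Q`. -/
def rpart (P Q : SpecialPoset) (s : Finset (Fin (P * Q).card)) : Finset (Fin Q.card) :=
  Finset.univ.filter fun i => inr P Q i ∈ s

theorem union_parts (P Q : SpecialPoset) (s : Finset (Fin (P * Q).card)) :
    (lpart P Q s).image (inl P Q) ∪ (rpart P Q s).image (inr P Q) = s := by
  ext x
  rcases mul_cases P Q x with ⟨i, rfl⟩ | ⟨i, rfl⟩ <;> simp [lpart, rpart]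

theorem restrict_mul' (P Q : SpecialPoset) (s : Finset (Fin (P * Q).card)) :
    (P * Q).restrict s = P.restrict (lpart P Q s) * Q.restrict (rpart P Q s) := by
  rw [← restrict_mul, union_parts]

theorem sum_ideals_mul {M : Type*} [AddCommMonoid M] (P Q : SpecialPoset)
    (g : SpecialPoset → SpecialPoset → M) :
    ∑ I ∈ (P * Q).ideals, g ((P * Q).restrict Iᶜ) ((P * Q).restrict I) =
      ∑ I ∈ P.ideals, ∑ J ∈ Q.ideals,
        g (P.restrict Iᶜ * Q.restrict Jᶜ) (P.restrict I * Q.restrict J) := by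
  rw [← Finset.sum_product']
  refine Finset.sum_bij' (fun K _ => (lpart P Q K, rpart P Q K))
    (fun p _ => p.1.image (inl P Q) ∪ p.2.image (inr P Q)) ?_ ?_ ?_ ?_ ?_
  · intro K hK
    rw [mem_ideals] at hK
    simp only [Finset.mem_product, mem_ideals, lpart, rpart, Finset.mem_filter,
      Finset.mem_univ, true_and]
    exact ⟨fun x hx y h => hK _ hx _ (by simpa using h),
      fun x hx y h => hK _ hx _ (by simpa using h)⟩
  · rintro ⟨I, J⟩ h
    simp only [Finset.mem_product, mem_ideals] at h
    rw [mem_ideals]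
    intro x hx y hxy
    rcases mul_cases P Q x with ⟨x, rfl⟩ | ⟨x, rfl⟩ <;>
      rcases mul_cases P Q y with ⟨y, rfl⟩ | ⟨y, rfl⟩ <;> simp at hx hxy ⊢
    · exact h.1 _ hx _ hxy
    · exact h.2 _ hx _ hxy
  · intro K _
    exact union_parts P Q K
  · rintro ⟨I, J⟩ _
    ext x <;> simp [lpart, rpart]
  · intro K _
    have h1 : lpart P Q Kᶜ = (lpart P Q K)ᶜ := by ext; simp [lpart]
    have h2 : rpart P Q Kᶜ = (rpart P Q K)ᶜ := by ext; simp [rpart]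
    rw [restrict_mul', restrict_mul', h1, h2]

theorem sum_ideals_restrict {M : Type*} [AddCommMonoid M] (P : SpecialPoset)
    (s : Finset (Fin P.card)) (g : SpecialPoset → SpecialPoset → M) [DecidablePred
      fun J : Finset (Fin P.card) => J ⊆ s ∧ ∀ x ∈ J, ∀ y ∈ s, P.le x y → y ∈ J] :
    ∑ J ∈ (P.restrict s).ideals, g ((P.restrict s).restrict Jᶜ) ((P.restrict s).restrict J) =
      ∑ J with J ⊆ s ∧ ∀ x ∈ J, ∀ y ∈ s, P.le x y → y ∈ J,
        g (P.restrict (s \ J)) (P.restrict J) := by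
  have himg : ∀ J : Finset (Fin (P.restrict s).card),
      Jᶜ.image (incl P s) = s \ J.image (incl P s) := by
    intro J
    ext x
    simp only [Finset.mem_image, Finset.mem_compl, Finset.mem_sdiff]
    constructor
    · rintro ⟨i, hi, rfl⟩
      refine ⟨incl_mem i, ?_⟩
      rintro ⟨j, hj, hji⟩
      exact hi (incl_strictMono.injective hji ▸ hj)
    · rintro ⟨hx, h⟩
      obtain ⟨i, rfl⟩ := exists_incl hx
      exact ⟨i, fun hi => h ⟨i, hi, rfl⟩, rfl⟩
  refine Finset.sum_bij (fun J _ => J.image (incl P s)) ?_ ?_ ?_ ?_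
  · intro J hJ
    rw [mem_ideals] at hJ
    simp only [Finset.mem_filter, Finset.mem_univ, true_and]
    constructor
    · intro x hx
      obtain ⟨i, _, rfl⟩ := Finset.mem_image.1 hx
      exact incl_mem i
    · intro x hx y hy hxy
      obtain ⟨i, hi, rfl⟩ := Finset.mem_image.1 hx
      obtain ⟨j, rfl⟩ := exists_incl hy
      exact Finset.mem_image_of_mem _ (hJ i hi j hxy)
  · intro J _ J' _ h
    exact Finset.image_injective incl_strictMono.injective h
  · intro J hJ
    simp only [Finset.mem_filter, Finset.mem_univ, true_and] at hJ
    refine ⟨Finset.univ.filter fun i => incl P s i ∈ J, ?_, ?_⟩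
    · rw [mem_ideals]
      intro x hx y hxy
      simp only [Finset.mem_filter, Finset.mem_univ, true_and] at hx ⊢
      exact hJ.2 _ hx _ (incl_mem y) hxy
    · ext x
      simp only [Finset.mem_image, Finset.mem_filter, Finset.mem_univ, true_and]
      constructor
      · rintro ⟨i, hi, rfl⟩
        exact hi
      · intro hx
        obtain ⟨i, rfl⟩ := exists_incl (hJ.1 hx)
        exact ⟨i, hx, rfl⟩
  · intro J _
    rw [restrict_restrict, restrict_restrict, himg]

/-- The two ways of cutting a special poset in three pieces agree. -/
theorem sum_ideals_coassoc {M : Type*} [AddCommMonoid M] (P : SpecialPoset)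
    (g : SpecialPoset → SpecialPoset → SpecialPoset → M) :
    ∑ I ∈ P.ideals, ∑ J ∈ (P.restrict Iᶜ).ideals,
        g ((P.restrict Iᶜ).restrict Jᶜ) ((P.restrict Iᶜ).restrict J) (P.restrict I) =
      ∑ I ∈ P.ideals, ∑ J ∈ (P.restrict I).ideals,
        g (P.restrict Iᶜ) ((P.restrict I).restrict Jᶜ) ((P.restrict I).restrict J) := by
  classical
  refine (Finset.sum_congr rfl fun I _ => sum_ideals_restrict P Iᶜ
    fun A B => g A B (P.restrict I)).trans (Eq.trans ?_ (Finset.sum_congr rfl fun I _ =>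
      sum_ideals_restrict P I fun A B => g (P.restrict Iᶜ) A B).symm)
  rw [Finset.sum_sigma', Finset.sum_sigma']
  refine Finset.sum_bij' (fun p _ => ⟨p.1 ∪ p.2, p.1⟩) (fun p _ => ⟨p.2, p.1 \ p.2⟩) ?_ ?_ ?_ ?_ ?_
  · rintro ⟨I, J⟩ h
    simp only [Finset.mem_sigma, mem_ideals, Finset.mem_filter, Finset.mem_univ, true_and] at h ⊢
    obtain ⟨hI, hJ, hJ'⟩ := h
    refine ⟨fun x hx y hxy => ?_, Finset.subset_union_left, fun x hx y _ hxy => hI x hx y hxy⟩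
    rw [Finset.mem_union] at hx ⊢
    by_cases hy : y ∈ I
    · exact Or.inl hy
    · rcases hx with hx | hx
      · exact Or.inl (hI _ hx _ hxy)
      · exact Or.inr (hJ' _ hx _ (by simpa using hy) hxy)
  · rintro ⟨I, J⟩ h
    simp only [Finset.mem_sigma, mem_ideals, Finset.mem_filter, Finset.mem_univ, true_and] at h ⊢
    obtain ⟨hI, hJ, hJ'⟩ := h
    refine ⟨fun x hx y hxy => hJ' x hx y (hI x (hJ hx) y hxy) hxy, fun x hx => ?_,
      fun x hx y hy hxy => ?_⟩
    · simp only [Finset.mem_sdiff, Finset.mem_compl] at hx ⊢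
      exact hx.2
    · simp only [Finset.mem_sdiff, Finset.mem_compl] at hx hy ⊢
      exact ⟨hI x hx.1 y hxy, hy⟩
  · rintro ⟨I, J⟩ h
    simp only [Finset.mem_sigma, mem_ideals, Finset.mem_filter, Finset.mem_univ, true_and] at h
    have : (I ∪ J) \ I = J := by
      rw [Finset.union_sdiff_left, Finset.sdiff_eq_self_iff_disjoint]
      exact Finset.disjoint_left.2 fun x hx => by simpa using h.2.1 hx
    simp [this]
  · rintro ⟨I, J⟩ h
    simp only [Finset.mem_sigma, mem_ideals, Finset.mem_filter, Finset.mem_univ, true_and] at h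
    simp [Finset.union_sdiff_of_subset h.2.1]
  · rintro ⟨I, J⟩ h
    simp only [Finset.mem_sigma, mem_ideals, Finset.mem_filter, Finset.mem_univ, true_and] at h
    have h1 : Iᶜ \ J = (I ∪ J)ᶜ := by ext; simp
    have h2 : (I ∪ J) \ I = J := by
      rw [Finset.union_sdiff_left, Finset.sdiff_eq_self_iff_disjoint]
      exact Finset.disjoint_left.2 fun x hx => by simpa using h.2.1 hx
    simp [h1, h2]

end SpecialPoset

/-- A set of special posets that is stable under products and under taking subsets. Such a set
spans a Hopf subalgebra of the Hopf algebra of special posets. -/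
structure HereditaryFamily extends Submonoid SpecialPoset where
  restrict_mem : ∀ P ∈ carrier, ∀ s : Finset (Fin P.card), P.restrict s ∈ carrier

namespace HereditaryFamily

/-- The elements of the family. -/
abbrev Elem (F : HereditaryFamily) : Type := F.toSubmonoid

/-- A subset of an element of the family, as an element of the family. -/
def sub {F : HereditaryFamily} (P : F.Elem) (s : Finset (Fin P.1.card)) : F.Elem :=
  ⟨P.1.restrict s, F.restrict_mem P.1 P.2 s⟩

end HereditaryFamily

/-- The vector space with basis a hereditary family of special posets. -/
def PosetHopf (K : Type*) [Field K] (F : HereditaryFamily) : Type _ := MonoidAlgebra K F.Elem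

namespace PosetHopf

variable {K : Type*} [Field K] {F : HereditaryFamily}

noncomputable instance : Ring (PosetHopf K F) := inferInstanceAs (Ring (MonoidAlgebra K F.Elem))

noncomputable instance : Algebra K (PosetHopf K F) :=
  inferInstanceAs (Algebra K (MonoidAlgebra K F.Elem))

variable (K) in
/-- The basis of `PosetHopf K F`. The product of two basis elements is the product of the special
posets. -/
noncomputable def of : F.Elem →* PosetHopf K F := MonoidAlgebra.of K F.Elem

/-- The linear extension of a map defined on the basis. -/
noncomputable def linearLift {V : Type*} [AddCommGroup V] [Module K V] (f : F.Elem → V) :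
    PosetHopf K F →ₗ[K] V :=
  (Finsupp.linearCombination K f).comp (MonoidAlgebra.coeffLinearEquiv K).toLinearMap

/-- The algebra morphism extending a monoid morphism defined on the basis. -/
noncomputable def algLift {A : Type*} [Ring A] [Algebra K A] (f : F.Elem →* A) :
    PosetHopf K F →ₐ[K] A :=
  MonoidAlgebra.lift K A F.Elem f

theorem linearLift_of {V : Type*} [AddCommGroup V] [Module K V] (f : F.Elem → V) (P : F.Elem) :
    linearLift f (of K P) = f P := by
  change Finsupp.linearCombination K f (MonoidAlgebra.single P (1 : K)).coeff = f P
  simp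

theorem algLift_of {A : Type*} [Ring A] [Algebra K A] (f : F.Elem →* A) (P : F.Elem) :
    algLift f (of K P) = f P :=
  MonoidAlgebra.lift_of f P

theorem algHom_ext {A : Type*} [Ring A] [Algebra K A] {f g : PosetHopf K F →ₐ[K] A}
    (h : ∀ P, f (of K P) = g (of K P)) : f = g :=
  (MonoidAlgebra.lift K A F.Elem).symm.injective (MonoidHom.ext h)

theorem linearMap_ext {V : Type*} [AddCommGroup V] [Module K V] {f g : PosetHopf K F →ₗ[K] V}
    (h : ∀ P, f (of K P) = g (of K P)) : f = g := by
  refine MonoidAlgebra.lhom_ext' fun P => ?_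
  ext
  exact h P

open Classical in
/-- Auxiliary extension of `of` by zero. -/
noncomputable def ofE (F : HereditaryFamily) (K : Type*) [Field K] (P : SpecialPoset) :
    PosetHopf K F :=
  if h : P ∈ F.toSubmonoid then of K ⟨P, h⟩ else 0

theorem ofE_val (P : F.Elem) : ofE F K P.1 = of K P := by
  simp [ofE]

theorem ofE_mul (P Q : F.Elem) : ofE F K (P.1 * Q.1) = of K P * of K Q := by
  rw [← map_mul, ← ofE_val]
  rfl

/-- The coproduct of a basis element: `Δ(P)` is the sum of the `(P \ I) ⊗ I`, over all ideals `I`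
of `P`. -/
noncomputable def comulBasis (P : F.Elem) : PosetHopf K F ⊗[K] PosetHopf K F :=
  ∑ I ∈ P.1.ideals, of K (HereditaryFamily.sub P Iᶜ) ⊗ₜ[K] of K (HereditaryFamily.sub P I)

theorem comulBasis_eq (P : F.Elem) : comulBasis (K := K) P =
    ∑ I ∈ P.1.ideals, ofE F K (P.1.restrict Iᶜ) ⊗ₜ[K] ofE F K (P.1.restrict I) := by
  simp only [comulBasis, ← ofE_val, HereditaryFamily.sub]

theorem comulBasis_one : comulBasis (K := K) (1 : F.Elem) = 1 := by
  have h : (1 : SpecialPoset).ideals = {∅} := by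
    ext I
    have : I = ∅ := Finset.eq_empty_of_forall_notMem fun x => x.elim0
    subst this
    simp [SpecialPoset.mem_ideals]
  rw [comulBasis_eq]
  have h1 : ∀ s, SpecialPoset.restrict 1 s = 1 := fun s =>
    SpecialPoset.eq_one_of_card (by
      rw [SpecialPoset.card_restrict]
      exact Finset.card_eq_zero.2 (Finset.eq_empty_of_forall_notMem fun x => x.elim0))
  have h2 : ofE F K 1 = 1 := (ofE_val (1 : F.Elem)).trans (map_one _)
  change ∑ I ∈ (1 : SpecialPoset).ideals, ofE F K (SpecialPoset.restrict 1 Iᶜ) ⊗ₜ[K]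
    ofE F K (SpecialPoset.restrict 1 I) = 1
  simp only [h1, h2, h, Finset.sum_singleton]
  rfl

theorem comulBasis_mul (P Q : F.Elem) :
    comulBasis (K := K) (P * Q) = comulBasis P * comulBasis Q := by
  rw [comulBasis_eq]
  refine (SpecialPoset.sum_ideals_mul P.1 Q.1 fun A B => ofE F K A ⊗ₜ[K] ofE F K B).trans ?_
  rw [comulBasis, comulBasis, Finset.sum_mul_sum]
  refine Finset.sum_congr rfl fun I _ => Finset.sum_congr rfl fun J _ => ?_
  rw [Algebra.TensorProduct.tmul_mul_tmul, ← ofE_mul, ← ofE_mul]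
  rfl

/-- The coproduct, as an algebra morphism. -/
noncomputable def comulAlg : PosetHopf K F →ₐ[K] PosetHopf K F ⊗[K] PosetHopf K F :=
  algLift
    { toFun := comulBasis
      map_one' := comulBasis_one
      map_mul' := comulBasis_mul }

/-- The counit, as an algebra morphism: it maps the empty special poset to `1` and all the other
ones to `0`. -/
noncomputable def counitAlg : PosetHopf K F →ₐ[K] K :=
  algLift
    { toFun := fun P => if P.1.card = 0 then 1 else 0
      map_one' := by simp [SpecialPoset.card_one]
      map_mul' := fun P Q => by
        simp only [Submonoid.coe_mul, SpecialPoset.card_mul]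
        by_cases h : P.1.card = 0 <;> simp [h] }

theorem comulAlg_of (P : F.Elem) : comulAlg (of K P) = comulBasis P := algLift_of _ P

theorem counitAlg_of (P : F.Elem) : counitAlg (of K P) = if P.1.card = 0 then 1 else 0 :=
  algLift_of _ P

noncomputable instance : Bialgebra K (PosetHopf K F) :=
  Bialgebra.ofAlgHom comulAlg counitAlg
    (by
      refine algHom_ext fun P => ?_
      have := SpecialPoset.sum_ideals_coassoc P.1
        (fun A B C => ofE F K A ⊗ₜ[K] (ofE F K B ⊗ₜ[K] ofE F K C))
      simp only [AlgHom.comp_apply, comulAlg_of]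
      conv_lhs => rw [comulBasis]
      conv_rhs => rw [comulBasis]
      simp only [map_sum, Algebra.TensorProduct.map_tmul, comulAlg_of, comulBasis_eq,
        TensorProduct.sum_tmul, TensorProduct.tmul_sum, AlgHom.id_apply]
      simp only [← ofE_val, HereditaryFamily.sub]
      exact this)
    (by
      refine algHom_ext fun P => ?_
      simp only [AlgHom.comp_apply, comulAlg_of]
      rw [comulBasis, map_sum, Finset.sum_eq_single_of_mem Finset.univ]
      · simp [counitAlg_of, HereditaryFamily.sub, SpecialPoset.card_restrict,
          SpecialPoset.restrict_univ]
      · simp [SpecialPoset.mem_ideals]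
      · intro I _ hI
        have : Iᶜ.card ≠ 0 := by simpa using hI
        simp [counitAlg_of, HereditaryFamily.sub, SpecialPoset.card_restrict, this])
    (by
      refine algHom_ext fun P => ?_
      simp only [AlgHom.comp_apply, comulAlg_of]
      rw [comulBasis, map_sum, Finset.sum_eq_single_of_mem ∅]
      · simp [counitAlg_of, HereditaryFamily.sub, SpecialPoset.card_restrict,
          SpecialPoset.restrict_univ]
      · simp [SpecialPoset.mem_ideals]
      · intro I _ hI
        have : I.card ≠ 0 := by simpa using hI
        simp [counitAlg_of, HereditaryFamily.sub, SpecialPoset.card_restrict, this])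

theorem comul_of (P : F.Elem) : Coalgebra.comul (R := K) (of K P) = comulBasis P :=
  comulAlg_of P

theorem counit_of (P : F.Elem) :
    Coalgebra.counit (R := K) (of K P) = if P.1.card = 0 then 1 else 0 :=
  counitAlg_of P

/-- The left antipode on the basis. -/
noncomputable def antipodeLeft (P : F.Elem) : PosetHopf K F :=
  if P.1.card = 0 then 1
  else -∑ I ∈ (P.1.ideals.erase ∅).attach,
    antipodeLeft (HereditaryFamily.sub P I.1ᶜ) * of K (HereditaryFamily.sub P I.1)
termination_by P.1.card
decreasing_by
  have h : I.1 ≠ ∅ := (Finset.mem_erase.1 I.2).1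
  simp only [HereditaryFamily.sub, SpecialPoset.card_restrict]
  have := Finset.card_compl_lt_iff_nonempty I.1 |>.2 (Finset.nonempty_iff_ne_empty.2 h)
  simpa using this

/-- The right antipode on the basis. -/
noncomputable def antipodeRight (P : F.Elem) : PosetHopf K F :=
  if P.1.card = 0 then 1
  else -∑ I ∈ (P.1.ideals.erase Finset.univ).attach,
    of K (HereditaryFamily.sub P I.1ᶜ) * antipodeRight (HereditaryFamily.sub P I.1)
termination_by P.1.card
decreasing_by
  have h : I.1 ≠ Finset.univ := (Finset.mem_erase.1 I.2).1
  simp only [HereditaryFamily.sub, SpecialPoset.card_restrict]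
  simpa using Finset.card_lt_card (Finset.ssubset_univ_iff.2 h)

theorem sub_univ (P : F.Elem) : HereditaryFamily.sub P Finset.univ = P :=
  Subtype.ext (SpecialPoset.restrict_univ P.1)

theorem sub_empty (P : F.Elem) : HereditaryFamily.sub P ∅ = 1 :=
  Subtype.ext (SpecialPoset.restrict_empty P.1)

theorem antipodeLeft_sum (P : F.Elem) :
    ∑ I ∈ P.1.ideals, antipodeLeft (K := K) (HereditaryFamily.sub P Iᶜ) *
      of K (HereditaryFamily.sub P I) = if P.1.card = 0 then 1 else 0 := by
  have h0 : (∅ : Finset (Fin P.1.card)) ∈ P.1.ideals := by simp [SpecialPoset.mem_ideals]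
  rw [← Finset.add_sum_erase _ _ h0, Finset.compl_empty, sub_univ, sub_empty, map_one, mul_one]
  by_cases h : P.1.card = 0
  · have he : P.1.ideals.erase ∅ = ∅ := by
      refine Finset.eq_empty_of_forall_notMem fun I hI => (Finset.mem_erase.1 hI).1 ?_
      exact Finset.eq_empty_of_forall_notMem fun x => (h ▸ x).elim0
    rw [he, Finset.sum_empty, add_zero, antipodeLeft, if_pos h, if_pos h]
  · rw [antipodeLeft, if_neg h, if_neg h]
    rw [Finset.sum_attach (P.1.ideals.erase ∅) fun I =>
      antipodeLeft (K := K) (HereditaryFamily.sub P Iᶜ) * of K (HereditaryFamily.sub P I)]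
    exact neg_add_cancel _

theorem antipodeRight_sum (P : F.Elem) :
    ∑ I ∈ P.1.ideals, of K (HereditaryFamily.sub P Iᶜ) *
      antipodeRight (K := K) (HereditaryFamily.sub P I) = if P.1.card = 0 then 1 else 0 := by
  have h0 : (Finset.univ : Finset (Fin P.1.card)) ∈ P.1.ideals := by simp [SpecialPoset.mem_ideals]
  rw [← Finset.add_sum_erase _ _ h0, Finset.compl_univ, sub_univ, sub_empty, map_one, one_mul]
  by_cases h : P.1.card = 0
  · have he : P.1.ideals.erase Finset.univ = ∅ := by
      refine Finset.eq_empty_of_forall_notMem fun I hI => (Finset.mem_erase.1 hI).1 ?_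
      exact Finset.eq_univ_of_forall fun x => (h ▸ x).elim0
    rw [he, Finset.sum_empty, add_zero, antipodeRight, if_pos h, if_pos h]
  · rw [antipodeRight, if_neg h, if_neg h]
    rw [Finset.sum_attach (P.1.ideals.erase Finset.univ) fun I =>
      of K (HereditaryFamily.sub P Iᶜ) * antipodeRight (K := K) (HereditaryFamily.sub P I)]
    exact neg_add_cancel _

theorem algebraMap_counit_of (P : F.Elem) :
    algebraMap K (PosetHopf K F) (Coalgebra.counit (R := K) (of K P)) =
      if P.1.card = 0 then 1 else 0 := by
  rw [counit_of]
  split_ifs <;> simp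

theorem antipodeLeft_conv : LinearMap.mul' K (PosetHopf K F) ∘ₗ
    (linearLift antipodeLeft).rTensor (PosetHopf K F) ∘ₗ Coalgebra.comul =
      Algebra.linearMap K (PosetHopf K F) ∘ₗ Coalgebra.counit := by
  refine linearMap_ext fun P => ?_
  simp only [LinearMap.comp_apply, comul_of, comulBasis, map_sum, LinearMap.rTensor_tmul,
    linearLift_of, LinearMap.mul'_apply, Algebra.linearMap_apply, algebraMap_counit_of]
  exact antipodeLeft_sum P

theorem antipodeRight_conv : LinearMap.mul' K (PosetHopf K F) ∘ₗ
    (linearLift antipodeRight).lTensor (PosetHopf K F) ∘ₗ Coalgebra.comul =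
      Algebra.linearMap K (PosetHopf K F) ∘ₗ Coalgebra.counit := by
  refine linearMap_ext fun P => ?_
  simp only [LinearMap.comp_apply, comul_of, comulBasis, map_sum, LinearMap.lTensor_tmul,
    linearLift_of, LinearMap.mul'_apply, Algebra.linearMap_apply, algebraMap_counit_of]
  exact antipodeRight_sum P

theorem antipodeLeft_eq_antipodeRight :
    (linearLift antipodeLeft : PosetHopf K F →ₗ[K] PosetHopf K F) = linearLift antipodeRight := by
  have h1 : WithConv.toConv (linearLift antipodeLeft : PosetHopf K F →ₗ[K] PosetHopf K F) *
      WithConv.toConv LinearMap.id = 1 := by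
    rw [LinearMap.convMul_def, LinearMap.convOne_def]
    exact congrArg WithConv.toConv antipodeLeft_conv
  have h2 : WithConv.toConv LinearMap.id *
      WithConv.toConv (linearLift antipodeRight : PosetHopf K F →ₗ[K] PosetHopf K F) = 1 := by
    rw [LinearMap.convMul_def, LinearMap.convOne_def]
    exact congrArg WithConv.toConv antipodeRight_conv
  exact WithConv.toConv_injective (left_inv_eq_right_inv h1 h2)

noncomputable instance : HopfAlgebra K (PosetHopf K F) where
  antipode := linearLift antipodeLeft
  mul_antipode_rTensor_comul := antipodeLeft_conv
  mul_antipode_lTensor_comul := by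
    rw [antipodeLeft_eq_antipodeRight]
    exact antipodeRight_conv

end PosetHopf


/-- The family of all special posets. -/
def allSpecialPosets : HereditaryFamily where
  toSubmonoid := ⊤
  restrict_mem _ _ _ := Submonoid.mem_top _

/-- The family of the heap-ordered forests. -/
def heapOrderedForests : HereditaryFamily where
  carrier := {P | P.IsHeapOrdered ∧ P.IsForest}
  one_mem' := ⟨fun x => x.elim0, fun x => x.elim0⟩
  mul_mem' := by
    rintro P Q ⟨hP, hP'⟩ ⟨hQ, hQ'⟩
    constructor
    · intro x y h
      rcases SpecialPoset.mul_cases P Q x with ⟨x, rfl⟩ | ⟨x, rfl⟩ <;>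
        rcases SpecialPoset.mul_cases P Q y with ⟨y, rfl⟩ | ⟨y, rfl⟩ <;> simp at h
      · exact hP x y h
      · exact not_lt.1 fun hh => not_lt.2 (hQ x y h) (by simpa using hh)
    · intro x y z h h'
      rcases SpecialPoset.mul_cases P Q x with ⟨x, rfl⟩ | ⟨x, rfl⟩ <;>
        rcases SpecialPoset.mul_cases P Q y with ⟨y, rfl⟩ | ⟨y, rfl⟩ <;>
        rcases SpecialPoset.mul_cases P Q z with ⟨z, rfl⟩ | ⟨z, rfl⟩ <;> simp at h h'
      · simpa using hP' x y z h h'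
      · simpa using hQ' x y z h h'
  restrict_mem := by
    rintro P ⟨hP, hP'⟩ s
    constructor
    · intro x y h
      exact SpecialPoset.incl_strictMono.le_iff_le.1 (hP _ _ h)
    · intro x y z h h'
      exact hP' _ _ _ h h'

section Algebras

variable (K : Type*) [Field K]

/-- The Hopf algebra of special posets. -/
abbrev hSP : Type _ := PosetHopf K allSpecialPosets

/-- The Hopf algebra of heap-ordered forests. -/
abbrev hHOF : Type _ := PosetHopf K heapOrderedForests

/-- A special poset, as an element of the Hopf algebra of special posets. -/
noncomputable def sp (P : SpecialPoset) : hSP K :=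
  PosetHopf.of K ⟨P, Submonoid.mem_top P⟩

/-- The inclusion of the Hopf algebra of heap-ordered forests in the Hopf algebra of special
posets. -/
noncomputable def hofIncl : hHOF K →ₐc[K] hSP K :=
  BialgHom.ofAlgHom
    (PosetHopf.algLift
      { toFun := fun P => sp K P.1
        map_one' := rfl
        map_mul' := fun P Q =>
          map_mul (PosetHopf.of K) (⟨P.1, Submonoid.mem_top P.1⟩ : allSpecialPosets.Elem)
            ⟨Q.1, Submonoid.mem_top Q.1⟩ })
    (by
      refine PosetHopf.algHom_ext fun P => ?_
      simp only [AlgHom.comp_apply, PosetHopf.algLift_of]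
      exact (PosetHopf.counit_of (K := K) _).trans (PosetHopf.counit_of (K := K) P).symm)
    (by
      refine PosetHopf.algHom_ext fun P => ?_
      simp only [AlgHom.comp_apply, PosetHopf.algLift_of]
      refine Eq.trans ?_ (PosetHopf.comul_of (K := K) _).symm
      refine (congrArg _ (PosetHopf.comul_of (K := K) P)).trans ?_
      rw [PosetHopf.comulBasis, map_sum]
      simp only [Algebra.TensorProduct.map_tmul, PosetHopf.algLift_of]
      rfl)

theorem hofIncl_of (P : heapOrderedForests.Elem) : hofIncl K (PosetHopf.of K P) = sp K P.1 :=
  PosetHopf.algLift_of _ P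

/-- The pictures between two special posets. -/
def Picture (P Q : SpecialPoset) : Type :=
  {f : Fin P.card ≃ Fin Q.card //
    ∀ i j, (P.le i j → f i ≤ f j) ∧ (Q.le (f i) (f j) → i ≤ j)}

/-- The Hopf pairing: the pairing of two special posets is the number of pictures between them. -/
noncomputable def pairing : hSP K →ₗ[K] hSP K →ₗ[K] K :=
  PosetHopf.linearLift fun P => PosetHopf.linearLift fun Q => (Nat.card (Picture P.1 Q.1) : K)

/-- The two local transformations: `LocalRule K P u` means that `u` is obtained from the special
poset `P` by the transformation of `P` in `P₁ - P₂`, where an edge from `j` to `i` with `i < j` is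
removed (resp. reversed), or of `P` in `P₃ - P₄ + P₅`, where two edges from `i` to `k` and from
`j` to `k`, with `i < j < k`, are modified. -/
inductive LocalRule (P : SpecialPoset) : hSP K → Prop
  | first (i j : Fin P.card) (hij : i < j) (h : (j, i) ∈ P.hasse) :
    LocalRule P
      (sp K (.generate (P.hasse \ {(j, i)}) (SpecialPoset.acyclic_of_subset Set.sdiff_subset))
        - sp K (.generate (insert (i, j) (P.hasse \ {(j, i)})) (SpecialPoset.acyclic_reverse h)))
  | second (i j k : Fin P.card) (hij : i < j) (hjk : j < k) (hi : (i, k) ∈ P.hasse)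
      (hj : (j, k) ∈ P.hasse) :
    LocalRule P
      (sp K (.generate (P.hasse \ {(j, k)}) (SpecialPoset.acyclic_of_subset Set.sdiff_subset))
        - sp K (.generate (insert (i, j) (P.hasse \ {(j, k)}))
          (SpecialPoset.acyclic_graft hij hi hj))
        + sp K (.generate ((P.hasse \ {(j, k), (i, k)}) ∪ {(i, j), (j, k)})
          (SpecialPoset.acyclic_chain hij hi hj)))

/-- The coefficient of a special poset in a linear combination of special posets. -/
noncomputable def coeff (x : hSP K) (P : SpecialPoset) : K :=
  MonoidAlgebra.coeff (R := K) (M := allSpecialPosets.Elem) x ⟨P, Submonoid.mem_top P⟩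

/-- One rewriting step, applied to a special poset `P` that appears in `x`: the whole term of `x`
in `P` is replaced. -/
def Rewrite (x y : hSP K) : Prop :=
  ∃ (P : SpecialPoset) (u : hSP K), LocalRule K P u ∧ coeff K x P ≠ 0 ∧ y = x - coeff K x P • sp K P + coeff K x P • u

/-- One rewriting step of the most general kind: `x` is written in any way as `c • P + r`, without
any condition on `r`, and this occurrence of `P` is replaced. In this way, several occurrences of
the same special poset can be transformed differently. -/
def PartialRewrite (x y : hSP K) : Prop :=
  ∃ (P : SpecialPoset) (u : hSP K) (c : K) (r : hSP K), LocalRule K P u ∧ x = c • sp K P + r ∧ y = c • u + r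

end Algebras

/-- The disjoint union of the symmetric groups. -/
abbrev Permutations : Type := Σ n : ℕ, Equiv.Perm (Fin n)

/-- The vector space of free quasi-symmetric functions, with basis the set of permutations. -/
def FQSym (K : Type*) [Field K] : Type _ := Permutations →₀ K

namespace FQSym

variable {K : Type*} [Field K]

noncomputable instance : AddCommGroup (FQSym K) := inferInstanceAs (AddCommGroup (_ →₀ K))

noncomputable instance : Module K (FQSym K) := inferInstanceAs (Module K (_ →₀ K))

variable (K) in
/-- The basis of `FQSym`. -/
noncomputable def basis {n : ℕ} (σ : Equiv.Perm (Fin n)) : FQSym K :=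
  Finsupp.single (⟨n, σ⟩ : Permutations) (1 : K)

/-- The linear extension of a map defined on the basis. -/
noncomputable def linearLift {V : Type*} [AddCommGroup V] [Module K V]
    (f : ∀ n : ℕ, Equiv.Perm (Fin n) → V) : FQSym K →ₗ[K] V :=
  Finsupp.linearCombination K fun p : Permutations => f p.1 p.2

theorem linearLift_basis {V : Type*} [AddCommGroup V] [Module K V]
    (f : ∀ n : ℕ, Equiv.Perm (Fin n) → V) {n : ℕ} (σ : Equiv.Perm (Fin n)) :
    linearLift f (basis K σ) = f n σ :=
  (Finsupp.linearCombination_single K (1 : K) _).trans (one_smul K _)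

theorem linearMap_ext {V : Type*} [AddCommGroup V] [Module K V] {f g : FQSym K →ₗ[K] V}
    (h : ∀ (n : ℕ) (σ : Equiv.Perm (Fin n)), f (basis K σ) = g (basis K σ)) : f = g := by
  refine Finsupp.lhom_ext' fun p => ?_
  ext
  exact h p.1 p.2

/-- The permutation `σ ⊗ τ`, acting by `σ` on the first `k` elements and by `τ` on the last `l`
ones. -/
def tensor {k l : ℕ} (σ : Equiv.Perm (Fin k)) (τ : Equiv.Perm (Fin l)) :
    Equiv.Perm (Fin (k + l)) :=
  finSumFinEquiv.permCongr (Equiv.sumCongr σ τ)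

open Classical in
/-- The `(k, l)`-shuffles: the permutations whose inverse is increasing on the first `k` elements
and on the last `l` ones. -/
noncomputable def shuffles (k l : ℕ) : Finset (Equiv.Perm (Fin (k + l))) :=
  Finset.univ.filter fun ε => StrictMono (fun i : Fin k => ε.symm (Fin.castAdd l i)) ∧
    StrictMono (fun j : Fin l => ε.symm (Fin.natAdd k j))

/-- The product of two permutations in `FQSym`. -/
noncomputable def mulBasis {k l : ℕ} (σ : Equiv.Perm (Fin k)) (τ : Equiv.Perm (Fin l)) :
    FQSym K :=
  ∑ ε ∈ shuffles k l, basis K (tensor σ τ * ε)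

/-- The bilinear extension of the product of permutations. -/
noncomputable def mulLin : FQSym K →ₗ[K] FQSym K →ₗ[K] FQSym K :=
  linearLift fun _ σ => linearLift fun _ τ => mulBasis σ τ

theorem mulLin_basis {k l : ℕ} (σ : Equiv.Perm (Fin k)) (τ : Equiv.Perm (Fin l)) :
    mulLin (basis K σ) (basis K τ) = mulBasis σ τ := by
  rw [mulLin, linearLift_basis, linearLift_basis]

/-- The permutations `ρ` such that the letters in a block, read in the order in which they appear
in `ρ`, form the word `σ`. -/
def Compat {k n : ℕ} (f : Fin k → Fin n) (σ : Equiv.Perm (Fin k)) (ρ : Equiv.Perm (Fin n)) :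
    Prop :=
  StrictMono fun i => ρ.symm (f (σ i))

theorem tensor_castAdd {k l : ℕ} (σ : Equiv.Perm (Fin k)) (τ : Equiv.Perm (Fin l)) (i : Fin k) :
    tensor σ τ (Fin.castAdd l i) = Fin.castAdd l (σ i) := by
  simp [tensor, Equiv.permCongr_apply]

theorem tensor_natAdd {k l : ℕ} (σ : Equiv.Perm (Fin k)) (τ : Equiv.Perm (Fin l)) (i : Fin l) :
    tensor σ τ (Fin.natAdd k i) = Fin.natAdd k (τ i) := by
  simp [tensor, Equiv.permCongr_apply]

open Classical in
theorem mulBasis_eq {k l : ℕ} (σ : Equiv.Perm (Fin k)) (τ : Equiv.Perm (Fin l)) :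
    mulBasis (K := K) σ τ = ∑ ρ : Equiv.Perm (Fin (k + l)),
      if Compat (Fin.castAdd l) σ ρ ∧ Compat (Fin.natAdd k) τ ρ then basis K ρ else 0 := by
  rw [mulBasis, shuffles, Finset.sum_filter]
  refine Fintype.sum_equiv (Equiv.mulLeft (tensor σ τ)) _ _ fun ε => ?_
  have h : ∀ x, (tensor σ τ * ε).symm (tensor σ τ x) = ε.symm x := by
    intro x
    rw [Equiv.symm_apply_eq, Equiv.Perm.mul_apply, Equiv.apply_symm_apply]
  simp only [Equiv.coe_mulLeft, Compat, ← tensor_castAdd σ τ, ← tensor_natAdd σ τ, h]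

theorem exists_compat {k n : ℕ} (f : Fin k → Fin n) (hf : Function.Injective f)
    (π : Equiv.Perm (Fin n)) :
    ∃ ρ : Equiv.Perm (Fin k), ∀ ρ' : Equiv.Perm (Fin k), Compat f ρ' π ↔ ρ' = ρ := by
  have hinj : Function.Injective fun i => π.symm (f i) := π.symm.injective.comp hf
  refine ⟨Tuple.sort fun i => π.symm (f i), fun ρ' => ⟨fun h => ?_, fun h => ?_⟩⟩
  · have h' : Monotone ((fun i => π.symm (f i)) ∘ ρ') := h.monotone
    have := Tuple.unique_monotone h' (Tuple.monotone_sort fun i => π.symm (f i))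
    ext i
    exact congrArg Fin.val (hinj (congrFun this i))
  · subst h
    exact (Tuple.monotone_sort fun i => π.symm (f i)).strictMono_of_injective
      (hinj.comp (Equiv.injective _))

theorem compat_comp {j k n : ℕ} {f : Fin k → Fin n} {g : Fin j → Fin k}
    {σ : Equiv.Perm (Fin j)} {ρ : Equiv.Perm (Fin k)} {π : Equiv.Perm (Fin n)}
    (h : Compat f ρ π) : Compat g σ ρ ↔ Compat (fun i => f (g i)) σ π := by
  have key : ∀ x y, ρ.symm x < ρ.symm y ↔ π.symm (f x) < π.symm (f y) := by
    intro x y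
    have := h.lt_iff_lt (a := ρ.symm x) (b := ρ.symm y)
    simpa using this.symm
  constructor
  · intro hg a b hab
    exact (key _ _).1 (hg hab)
  · intro hg a b hab
    exact (key _ _).2 (hg hab)

theorem basis_cast {m n : ℕ} (h : m = n) (π : Equiv.Perm (Fin m)) :
    basis K ((finCongr h).permCongr π) = basis K π := by
  subst h
  rfl

theorem compat_cast {j m n : ℕ} (h : m = n) (π : Equiv.Perm (Fin m)) (f : Fin j → Fin m)
    (σ : Equiv.Perm (Fin j)) :
    Compat f σ π ↔ Compat (fun i => Fin.cast h (f i)) σ ((finCongr h).permCongr π) := by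
  subst h
  rfl

open Classical in
theorem mul_mul_left {j k l : ℕ} (σ : Equiv.Perm (Fin j)) (τ : Equiv.Perm (Fin k))
    (υ : Equiv.Perm (Fin l)) : mulLin (K := K) (mulLin (basis K σ) (basis K τ)) (basis K υ) =
      ∑ π : Equiv.Perm (Fin (j + k + l)),
        if Compat (fun i => Fin.castAdd l (Fin.castAdd k i)) σ π ∧
            Compat (fun i => Fin.castAdd l (Fin.natAdd j i)) τ π ∧ Compat (Fin.natAdd (j + k)) υ π
          then basis K π else 0 := by
  rw [mulLin_basis, mulBasis_eq, map_sum, LinearMap.sum_apply]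
  have h1 : ∀ ρ : Equiv.Perm (Fin (j + k)),
      mulLin (K := K) (if Compat (Fin.castAdd k) σ ρ ∧ Compat (Fin.natAdd j) τ ρ
        then basis K ρ else 0) (basis K υ) = ∑ π : Equiv.Perm (Fin (j + k + l)),
          if (Compat (Fin.castAdd k) σ ρ ∧ Compat (Fin.natAdd j) τ ρ) ∧
            Compat (Fin.castAdd l) ρ π ∧ Compat (Fin.natAdd (j + k)) υ π
          then basis K π else 0 := by
    intro ρ
    split_ifs with h
    · rw [mulLin_basis, mulBasis_eq]
      simp only [h, true_and, and_self]
    · simp [h]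
  rw [Finset.sum_congr rfl fun ρ _ => h1 ρ, Finset.sum_comm]
  refine Finset.sum_congr rfl fun π _ => ?_
  obtain ⟨ρ, hρ⟩ := exists_compat (Fin.castAdd l) (Fin.castAdd_injective (j + k) l) π
  rw [Finset.sum_eq_single_of_mem ρ (Finset.mem_univ _)]
  · have hc := (hρ ρ).2 rfl
    rw [compat_comp hc, compat_comp hc]
    simp only [hc, true_and, and_assoc]
  · intro ρ' _ hne
    rw [if_neg]
    rintro ⟨_, h, _⟩
    exact hne ((hρ ρ').1 h)

open Classical in
theorem mul_mul_right {j k l : ℕ} (σ : Equiv.Perm (Fin j)) (τ : Equiv.Perm (Fin k))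
    (υ : Equiv.Perm (Fin l)) : mulLin (K := K) (basis K σ) (mulLin (basis K τ) (basis K υ)) =
      ∑ π : Equiv.Perm (Fin (j + (k + l))),
        if Compat (Fin.castAdd (k + l)) σ π ∧
            Compat (fun i => Fin.natAdd j (Fin.castAdd l i)) τ π ∧
            Compat (fun i => Fin.natAdd j (Fin.natAdd k i)) υ π
          then basis K π else 0 := by
  rw [mulLin_basis, mulBasis_eq, map_sum]
  have h1 : ∀ ρ : Equiv.Perm (Fin (k + l)),
      mulLin (K := K) (basis K σ) (if Compat (Fin.castAdd l) τ ρ ∧ Compat (Fin.natAdd k) υ ρ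
        then basis K ρ else 0) = ∑ π : Equiv.Perm (Fin (j + (k + l))),
          if (Compat (Fin.castAdd l) τ ρ ∧ Compat (Fin.natAdd k) υ ρ) ∧
            Compat (Fin.castAdd (k + l)) σ π ∧ Compat (Fin.natAdd j) ρ π
          then basis K π else 0 := by
    intro ρ
    split_ifs with h
    · rw [mulLin_basis, mulBasis_eq]
      simp only [h, true_and, and_self]
    · simp [h]
  rw [Finset.sum_congr rfl fun ρ _ => h1 ρ, Finset.sum_comm]
  refine Finset.sum_congr rfl fun π _ => ?_
  obtain ⟨ρ, hρ⟩ := exists_compat (Fin.natAdd j) (Fin.natAdd_injective (k + l) j) π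
  rw [Finset.sum_eq_single_of_mem ρ (Finset.mem_univ _)]
  · have hc := (hρ ρ).2 rfl
    rw [compat_comp hc, compat_comp hc]
    refine if_congr ?_ rfl rfl
    tauto
  · intro ρ' _ hne
    rw [if_neg]
    rintro ⟨_, _, h⟩
    exact hne ((hρ ρ').1 h)

theorem mul_assoc_basis {j k l : ℕ} (σ : Equiv.Perm (Fin j)) (τ : Equiv.Perm (Fin k))
    (υ : Equiv.Perm (Fin l)) : mulLin (K := K) (mulLin (basis K σ) (basis K τ)) (basis K υ) =
      mulLin (basis K σ) (mulLin (basis K τ) (basis K υ)) := by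
  classical
  rw [mul_mul_left, mul_mul_right]
  refine Fintype.sum_equiv (finCongr (Nat.add_assoc j k l)).permCongr _ _ fun π => ?_
  rw [basis_cast]
  refine if_congr ?_ rfl rfl
  rw [compat_cast (Nat.add_assoc j k l), compat_cast (Nat.add_assoc j k l),
    compat_cast (Nat.add_assoc j k l)]
  have h1 : (fun i : Fin j => Fin.cast (Nat.add_assoc j k l) (Fin.castAdd l (Fin.castAdd k i))) =
      Fin.castAdd (k + l) := by
    funext i
    exact Fin.ext rfl
  have h2 : (fun i : Fin k => Fin.cast (Nat.add_assoc j k l) (Fin.castAdd l (Fin.natAdd j i))) =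
      fun i => Fin.natAdd j (Fin.castAdd l i) := by
    funext i
    exact Fin.ext rfl
  have h3 : (fun i : Fin l => Fin.cast (Nat.add_assoc j k l) (Fin.natAdd (j + k) i)) =
      fun i => Fin.natAdd j (Fin.natAdd k i) := by
    funext i
    exact Fin.ext (Nat.add_assoc j k i)
  rw [h1, h2, h3]

theorem compat_id {k : ℕ} (σ ρ : Equiv.Perm (Fin k)) : Compat (fun i => i) σ ρ ↔ ρ = σ := by
  constructor
  · intro h
    obtain ⟨ρ₀, h₀⟩ := exists_compat (fun i : Fin k => i) (fun _ _ h => h) ρ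
    have h1 : Compat (fun i => i) ρ ρ := by
      intro a b hab
      simpa using hab
    exact ((h₀ ρ).1 h1).trans ((h₀ σ).1 h).symm
  · rintro rfl a b hab
    simpa using hab

theorem one_mul_basis {k : ℕ} (σ : Equiv.Perm (Fin k)) :
    mulLin (basis K (1 : Equiv.Perm (Fin 0))) (basis K σ) = basis K σ := by
  classical
  rw [mulLin_basis, mulBasis_eq]
  have hc : ∀ ρ : Equiv.Perm (Fin (0 + k)), (Compat (Fin.castAdd k) 1 ρ ∧
      Compat (Fin.natAdd 0) σ ρ) ↔ ρ = (finCongr (Nat.zero_add k).symm).permCongr σ := by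
    intro ρ
    have h0 : Compat (Fin.castAdd k) (1 : Equiv.Perm (Fin 0)) ρ := fun i => i.elim0
    have h1 : (fun i : Fin k => Fin.cast (Nat.zero_add k) (Fin.natAdd 0 i)) = fun i => i := by
      funext i
      exact Fin.ext (Nat.zero_add _)
    rw [compat_cast (Nat.zero_add k), compat_cast (Nat.zero_add k), h1, compat_id]
    refine (and_iff_right fun i => i.elim0).trans ?_
    exact (Equiv.eq_symm_apply (finCongr (Nat.zero_add k)).permCongr).symm
  simp only [hc, Finset.sum_ite_eq', Finset.mem_univ, if_true, basis_cast]

theorem mul_one_basis {k : ℕ} (σ : Equiv.Perm (Fin k)) :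
    mulLin (basis K σ) (basis K (1 : Equiv.Perm (Fin 0))) = basis K σ := by
  classical
  rw [mulLin_basis, mulBasis_eq]
  have hc : ∀ ρ : Equiv.Perm (Fin (k + 0)), (Compat (Fin.castAdd 0) σ ρ ∧
      Compat (Fin.natAdd k) (1 : Equiv.Perm (Fin 0)) ρ) ↔ ρ = σ := by
    intro ρ
    have h0 : Compat (Fin.natAdd k) (1 : Equiv.Perm (Fin 0)) ρ := fun i => i.elim0
    exact (and_iff_left h0).trans (compat_id σ ρ)
  simp only [hc, Finset.sum_ite_eq', Finset.mem_univ, if_true]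

theorem induction_basis {p : FQSym K → Prop} (x : FQSym K) (h0 : p 0)
    (hadd : ∀ x y, p x → p y → p (x + y))
    (hs : ∀ (a : K) (n : ℕ) (σ : Equiv.Perm (Fin n)), p (a • basis K σ)) : p x := by
  refine Finsupp.induction_linear (motive := p) x h0 hadd fun q a => ?_
  have h : a • Finsupp.single q (1 : K) = Finsupp.single q a := by
    rw [Finsupp.smul_single, smul_eq_mul, mul_one]
  exact h ▸ hs a q.1 q.2

theorem mulLin_assoc (x y z : FQSym K) :
    mulLin (mulLin x y) z = mulLin x (mulLin y z) := by
  induction x using induction_basis with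
  | h0 => simp
  | hadd x x' h h' => simp [h, h']
  | hs a j σ =>
    induction y using induction_basis with
    | h0 => simp
    | hadd x x' h h' => simp only [map_add, LinearMap.add_apply, h, h']
    | hs b k τ =>
      induction z using induction_basis with
      | h0 => simp
      | hadd x x' h h' => simp only [map_add, h, h']
      | hs c l υ => simp only [map_smul, LinearMap.smul_apply, mul_assoc_basis]

/-- The algebra structure of `FQSym`: the product of two permutations `σ` and `τ` is the sum of
the permutations `(σ ⊗ τ) ∘ ε`, where `ε` is a shuffle. -/
noncomputable instance : Ring (FQSym K) :=
  { (inferInstance : AddCommGroup (FQSym K)) with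
    mul := fun x y => mulLin x y
    one := basis K (1 : Equiv.Perm (Fin 0))
    left_distrib := fun x y z => (mulLin x).map_add y z
    right_distrib := fun x y z => mulLin.map_add₂ x y z
    zero_mul := fun x => mulLin.map_zero₂ x
    mul_zero := fun x => (mulLin x).map_zero
    mul_assoc := mulLin_assoc
    one_mul := fun x => LinearMap.congr_fun (f := mulLin (basis K 1)) (g := LinearMap.id)
      (linearMap_ext fun _ σ => one_mul_basis σ) x
    mul_one := fun x => LinearMap.congr_fun (f := mulLin.flip (basis K 1)) (g := LinearMap.id)
      (linearMap_ext fun _ σ => mul_one_basis σ) x }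

noncomputable instance : Algebra K (FQSym K) :=
  Algebra.ofModule (fun a x y => mulLin.map_smul₂ a x y) fun a x y => (mulLin x).map_smul a y

/-- The standardization of a word `w` with distinct letters: the permutation whose letters are in
the same relative order as those of `w`. -/
def standardize {m n : ℕ} (w : Fin m → Fin n) : Equiv.Perm (Fin m) := (Tuple.sort w)⁻¹

/-- The coproduct of a permutation: the sum, over all the ways of cutting its word in two pieces,
of the tensor products of the standardizations of the two pieces. -/
noncomputable def comulBasis {n : ℕ} (σ : Equiv.Perm (Fin n)) : FQSym K ⊗[K] FQSym K :=
  ∑ k : Fin (n + 1),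
    basis K (standardize fun i : Fin k => σ (Fin.castLE (by omega) i)) ⊗ₜ[K]
      basis K (standardize fun i : Fin (n - k) => σ ⟨k + i, by omega⟩)

/-- The coalgebra structure of `FQSym`; the counit maps the empty permutation to `1` and all the
other ones to `0`. -/
noncomputable instance : CoalgebraStruct K (FQSym K) where
  comul := linearLift fun _ σ => comulBasis σ
  counit := linearLift fun n _ => if n = 0 then 1 else 0

end FQSym

open Classical in
/-- The linear extensions of a special poset `P` with `n` elements: the permutations `σ` such that
`i` appears before `j` in the word `σ(1) ... σ(n)` if `i` is smaller than `j` for the first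
order. -/
noncomputable def linearExtensions (P : SpecialPoset) : Finset (Equiv.Perm (Fin P.card)) :=
  Finset.univ.filter fun σ => ∀ i j, P.le i j → i ≠ j → σ⁻¹ i < σ⁻¹ j

/-- The map `Θ`, that sends a special poset to the sum of its linear extensions. -/
noncomputable def theta (K : Type*) [Field K] : hSP K →ₗ[K] FQSym K :=
  PosetHopf.linearLift fun P => ∑ σ ∈ linearExtensions P.1, FQSym.basis K σ

end SpecialPosets

open SpecialPosets

/-!
The map `Θ` is unchanged by both transformations: for a fixed permutation, removing `(j, i)` from
the constraints allows both orders of `i` and `j`, which gives the first one, and a similar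
inspection of the relative order of `i`, `j`, `k` gives the second one (`LocalRule.theta_eq`). So
everything follows once `Θ` is known to be a bijective bialgebra morphism on heap-ordered forests:
`Υ` is then `(Θ restricted to forests)⁻¹ ∘ Θ`, and any reduction of `x` to forests ends at `Υ x`.

*Termination.* Give an edge `(a, b)` of the Hasse graph the weight `b` if `a < b`, and `a + 1`
otherwise. Each transformation lowers the total weight of the Hasse graph, since a generating set
contains all the covers, and replaces one special poset by at most three. Hence the sum of the
numbers `4 ^ weight` over the terms of `x` decreases (`Rewrite.totalWeight_lt`). A special poset to
which no transformation applies has no inverted edge and no element covering two others, which means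
that it is a heap-ordered forest (`exists_localRule_iff`).

*Bijectivity.* Each permutation is the only linear extension of a chain, and a chain reduces to
forests with the same image under `Θ`; so `Θ` is surjective on forests. A heap-ordered forest with
`n` elements is determined by its parents, and the parent of an element is not larger than it (a root
being its own parent), so that there are at most `n!` such forests (`card_HOF_le`). A surjection in
each degree onto a space of dimension `n!` is then injective.

*Morphism.* Linear extensions of `PQ` are shuffles of linear extensions of `P` and `Q`
(`sum_linearExtensions_mul`), and a linear extension of `P` cut in two is a choice of an ideal
together with linear extensions of the two pieces (`sum_comulBasis_linearExtensions`).

*Pairing.* A picture between `P` and `Q` is a linear extension of `Q` whose inverse is a linear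
extension of `P`; so the pairing factors through `Θ` (`pairing_eq_invPairing`).
-/

namespace SpecialPosets

open scoped TensorProduct

/-! ### Hasse graphs and their weights -/

namespace SpecialPoset

/-- A cover can only be generated by itself. -/
theorem hasse_generate_subset {n : ℕ} {R : Set (Fin n × Fin n)} (h : Acyclic R) :
    (generate R h).hasse ⊆ R := by
  rintro ⟨a, b⟩ ⟨hab, hk⟩
  change Fin n at a b
  have hp : Path R a b := ((hk b).2 (Or.inr rfl)).1
  have key : ∀ x, Path R x b → x = a → (a, b) ∈ R := by
    intro x hx
    induction hx using Relation.ReflTransGen.head_induction_on with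
    | refl => exact fun hba => absurd hba.symm hab
    | head hxc hcb ih =>
      rintro rfl
      rcases (hk _).1 ⟨Relation.ReflTransGen.single hxc, hcb⟩ with hc | hc
      · exact ih hc
      · simp only at hc
        exact hc ▸ hxc
  exact key a hp rfl

/-- The weight of an edge from `a` to `b`: it is positive, it decreases when an inverted edge is
reversed, and for the other edges it only depends on, and increases with, the upper end. -/
def edgeWeight {n : ℕ} (e : Fin n × Fin n) : ℕ :=
  if e.1 < e.2 then e.2 else e.1 + 1

open Classical in
/-- The total weight of a set of edges. -/
noncomputable def edgesWeight {n : ℕ} (R : Set (Fin n × Fin n)) : ℕ :=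
  ∑ e with e ∈ R, edgeWeight e

theorem edgesWeight_mono {n : ℕ} {R S : Set (Fin n × Fin n)} (h : R ⊆ S) :
    edgesWeight R ≤ edgesWeight S :=
  Finset.sum_le_sum_of_subset fun e he => by
    simp only [Finset.mem_filter, Finset.mem_univ, true_and] at he ⊢
    exact h he

theorem edgesWeight_sdiff {n : ℕ} {R : Set (Fin n × Fin n)} {e : Fin n × Fin n} (he : e ∈ R) :
    edgesWeight (R \ {e}) + edgeWeight e = edgesWeight R := by
  classical
  refine Eq.trans (congrArg (· + edgeWeight e) (Finset.sum_congr
    (s₂ := (Finset.univ.filter fun x => x ∈ R).erase e) ?_ fun _ _ => rfl))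
    (Finset.sum_erase_add _ _ (by simpa using he))
  ext x
  simp [and_comm]

theorem edgesWeight_insert_le {n : ℕ} (R : Set (Fin n × Fin n)) (e : Fin n × Fin n) :
    edgesWeight (insert e R) ≤ edgesWeight R + edgeWeight e := by
  classical
  rw [← edgesWeight_sdiff (Set.mem_insert e R)]
  gcongr
  exact edgesWeight_mono (by simp)

/-- The total weight of the edges of the Hasse graph, which decreases in each transformation. -/
noncomputable def weight (P : SpecialPoset) : ℕ := edgesWeight P.hasse

theorem weight_generate_le {n : ℕ} {R : Set (Fin n × Fin n)} (h : Acyclic R) :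
    weight (generate R h) ≤ edgesWeight R :=
  edgesWeight_mono (hasse_generate_subset h)

/-- The first order of a special poset, as a `PartialOrder`. -/
abbrev leOrder (P : SpecialPoset) : PartialOrder (Fin P.card) where
  le := P.le
  lt x y := P.le x y ∧ ¬ P.le y x
  le_refl := refl_of P.le
  le_trans _ _ _ := trans_of P.le
  le_antisymm _ _ := antisymm_of P.le

/-- If `x` is strictly below `z`, some element above `x` is covered by `z`. -/
theorem exists_hasse_of_le {P : SpecialPoset} {x z : Fin P.card} (h : P.le x z) (hne : x ≠ z) :
    ∃ y, P.le x y ∧ (y, z) ∈ P.hasse := by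
  classical
  let := P.leOrder
  let : LocallyFiniteOrder (Fin P.card) := Fintype.toLocallyFiniteOrder
  obtain ⟨y, hy, hc⟩ := exists_le_covBy_of_lt (lt_of_le_of_ne h hne)
  refine ⟨y, hy, hc.1.ne, fun k => ⟨fun hk => hc.eq_or_eq hk.1 hk.2, ?_⟩⟩
  rintro (rfl | rfl)
  · exact ⟨refl_of P.le _, hc.1.le⟩
  · exact ⟨hc.1.le, refl_of P.le _⟩

theorem le_iff_path_hasse {P : SpecialPoset} {x y : Fin P.card} :
    P.le x y ↔ Path P.hasse x y := by
  refine ⟨fun h => ?_, path_le subset_rfl⟩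
  classical
  let := P.leOrder
  have hwf : WellFounded P.leOrder.lt :=
    (@Finite.to_wellFoundedLT _ _ P.leOrder.toPreorder).wf
  induction y using hwf.induction with
  | _ y ih =>
    by_cases hxy : x = y
    · exact hxy ▸ Relation.ReflTransGen.refl
    · obtain ⟨z, hz, hc⟩ := exists_hasse_of_le h hxy
      exact (ih z (lt_of_le_of_ne (hasse_le hc) hc.1) hz).tail hc

theorem isHeapOrdered_iff {P : SpecialPoset} :
    P.IsHeapOrdered ↔ ∀ i j, i < j → (j, i) ∉ P.hasse := by
  refine ⟨fun h i j hij hj => hij.not_ge (h _ _ (hasse_le hj)), fun h x y hxy => ?_⟩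
  induction le_iff_path_hasse.1 hxy with
  | refl => exact le_rfl
  | tail hp hc ih =>
    exact (ih (path_le subset_rfl hp)).trans (not_lt.1 fun hlt => h _ _ hlt hc)

theorem isForest_iff {P : SpecialPoset} (hP : P.IsHeapOrdered) :
    P.IsForest ↔ ∀ i j k, i < j → (i, k) ∈ P.hasse → (j, k) ∉ P.hasse := by
  refine ⟨fun h i j k hij hi hj => ?_, fun h => ?_⟩
  · rcases h i j k (hasse_le hi) (hasse_le hj) with hh | hh
    · rcases (hi.2 j).1 ⟨hh, hasse_le hj⟩ with h' | h'
      · exact hij.ne' h'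
      · exact hj.1 h'
    · exact not_le_of_hasse hij hi hj hh
  · intro x y z hx hy
    induction z using WellFoundedLT.induction with
    | ind z ih =>
      by_cases hxz : x = z
      · exact Or.inr (hxz ▸ hy)
      by_cases hyz : y = z
      · exact Or.inl (hyz ▸ hx)
      obtain ⟨x', hx', hxc⟩ := exists_hasse_of_le hx hxz
      obtain ⟨y', hy', hyc⟩ := exists_hasse_of_le hy hyz
      rcases lt_trichotomy x' y' with hlt | rfl | hlt
      · exact absurd hyc (h _ _ _ hlt hxc)
      · exact ih x' (lt_of_le_of_ne (hP _ _ (hasse_le hxc)) hxc.1) hx' hy'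
      · exact absurd hxc (h _ _ _ hlt hyc)

end SpecialPoset

open SpecialPoset

/-! ### Termination and normal forms of the rewriting -/

section Rewriting

variable {K : Type*} [Field K]

variable (K) in
/-- The coefficient of a special poset, as a linear form. -/
noncomputable def coeffLin (P : SpecialPoset) : hSP K →ₗ[K] K where
  toFun x := coeff K x P
  map_add' _ _ := rfl
  map_smul' _ _ := rfl

theorem coeffLin_apply (P : SpecialPoset) (x : hSP K) : coeffLin K P x = coeff K x P := rfl

theorem coeff_sp (P Q : SpecialPoset) [Decidable (P = Q)] :
    coeff K (sp K P) Q = if P = Q then 1 else 0 := by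
  classical
  change (MonoidAlgebra.single _ (1 : K)).coeff _ = _
  rw [MonoidAlgebra.coeff_single, Finsupp.single_apply]
  exact if_congr Subtype.mk_eq_mk rfl rfl

theorem coeff_sp_of_ne {P Q : SpecialPoset} (h : P ≠ Q) : coeff K (sp K P) Q = 0 := by
  classical
  rw [coeff_sp, if_neg h]

/-- The special posets that appear in a linear combination. -/
noncomputable def terms (x : hSP K) : Finset SpecialPoset :=
  (MonoidAlgebra.coeff (R := K) (M := allSpecialPosets.Elem) x).support.map
    (Function.Embedding.subtype _)

theorem mem_terms {x : hSP K} {P : SpecialPoset} : P ∈ terms x ↔ coeff K x P ≠ 0 := by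
  simp only [terms, Finset.mem_map, Finsupp.mem_support_iff, coeff]
  constructor
  · rintro ⟨⟨Q, hQ⟩, h, rfl⟩
    exact h
  · exact fun h => ⟨_, h, rfl⟩

theorem eq_sum_terms (x : hSP K) : x = ∑ P ∈ terms x, coeff K x P • sp K P := by
  rw [terms, Finset.sum_map]
  refine (MonoidAlgebra.sum_coeff_single x).symm.trans ?_
  refine Finset.sum_congr rfl fun P _ => ?_
  refine Eq.trans ?_ (MonoidAlgebra.smul_single _ _ _).symm
  rw [smul_eq_mul, mul_one]
  rfl

/-- Each transformation replaces a special poset by at most three lighter ones. -/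
theorem LocalRule.exists_lighter {P : SpecialPoset} {u : hSP K} (h : LocalRule K P u) :
    ∃ Q₁ Q₂ Q₃ : SpecialPoset, Q₁.weight < P.weight ∧ Q₂.weight < P.weight ∧
      Q₃.weight < P.weight ∧ ∀ Q, coeff K u Q ≠ 0 → Q = Q₁ ∨ Q = Q₂ ∨ Q = Q₃ := by
  cases h with
  | first i j hij h =>
    have hw := edgesWeight_sdiff h
    have h1 : edgeWeight (j, i) = j + 1 := by simp [edgeWeight, hij.le]
    have h2 : edgeWeight (i, j) = j := by simp [edgeWeight, hij]
    have hins := edgesWeight_insert_le (P.hasse \ {(j, i)}) (i, j)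
    refine ⟨_, _, _,
      (weight_generate_le (acyclic_of_subset (R := P.hasse \ {(j, i)})
        Set.sdiff_subset)).trans_lt ?_,
      (weight_generate_le (acyclic_reverse h)).trans_lt ?_,
      (weight_generate_le (acyclic_reverse h)).trans_lt ?_, ?_⟩
    · unfold weight; omega
    · unfold weight; omega
    · unfold weight; omega
    · intro Q hQ
      by_contra! hne
      apply hQ
      rw [← coeffLin_apply, map_sub, coeffLin_apply, coeffLin_apply,
        coeff_sp_of_ne hne.1.symm, coeff_sp_of_ne hne.2.1.symm, sub_zero]
  | second i j k hij hjk hi hj =>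
    have hik := hij.trans hjk
    have hwj := edgesWeight_sdiff hj
    have hwi := edgesWeight_sdiff hi
    have h1 : edgeWeight (i, j) = j := by simp [edgeWeight, hij]
    have h2 : edgeWeight (j, k) = k := by simp [edgeWeight, hjk]
    have h3 : edgeWeight (i, k) = k := by simp [edgeWeight, hik]
    have hins := edgesWeight_insert_le (P.hasse \ {(j, k)}) (i, j)
    have hins' := edgesWeight_insert_le (P.hasse \ {(i, k)}) (i, j)
    -- The chain `i, j, k` arises from the Hasse graph by replacing `(i, k)` with `(i, j)`.
    have hsub : P.hasse \ {(j, k), (i, k)} ∪ {(i, j), (j, k)} ⊆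
        insert (i, j) (P.hasse \ {(i, k)}) := by
      rintro e (⟨he, he'⟩ | rfl | rfl)
      · exact Or.inr ⟨he, fun h => he' (Or.inr h)⟩
      · exact Or.inl rfl
      · exact Or.inr ⟨hj, fun h => hij.ne' (Prod.mk.inj h).1⟩
    have hsub' := edgesWeight_mono hsub
    have hjk' : (j : ℕ) < k := hjk
    refine ⟨_, _, _,
      (weight_generate_le (acyclic_of_subset (R := P.hasse \ {(j, k)})
        Set.sdiff_subset)).trans_lt ?_,
      (weight_generate_le (acyclic_graft hij hi hj)).trans_lt ?_,
      (weight_generate_le (acyclic_chain hij hi hj)).trans_lt ?_, ?_⟩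
    · unfold weight; omega
    · unfold weight; omega
    · unfold weight; omega
    · intro Q hQ
      by_contra! hne
      apply hQ
      rw [← coeffLin_apply, map_add, map_sub, coeffLin_apply, coeffLin_apply, coeffLin_apply,
        coeff_sp_of_ne hne.1.symm, coeff_sp_of_ne hne.2.1.symm, coeff_sp_of_ne hne.2.2.symm,
        sub_zero, add_zero]

/-- A natural number attached to a linear combination, which decreases in each rewriting step. The
base `4` is such that three special posets lighter than `P` count less than `P`. -/
noncomputable def totalWeight (x : hSP K) : ℕ := ∑ P ∈ terms x, 4 ^ P.weight

theorem Rewrite.totalWeight_lt {x y : hSP K} (h : Rewrite K x y) :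
    totalWeight y < totalWeight x := by
  classical
  obtain ⟨P, u, hu, hP, rfl⟩ := h
  obtain ⟨Q₁, Q₂, Q₃, h1, h2, h3, hQ⟩ := hu.exists_lighter
  have hsub : terms (x - coeff K x P • sp K P + coeff K x P • u) ⊆
      (terms x).erase P ∪ {Q₁, Q₂, Q₃} := by
    intro Q hy
    rw [Finset.mem_union, Finset.mem_erase, mem_terms]
    by_contra! hcon
    simp only [Finset.mem_insert, Finset.mem_singleton, not_or] at hcon
    rw [mem_terms, ← coeffLin_apply] at hy
    simp only [map_add, map_sub, map_smul, coeffLin_apply, smul_eq_mul] at hy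
    have hu0 : coeff K u Q = 0 := by
      by_contra hne
      rcases hQ Q hne with h | h | h
      exacts [hcon.2.1 h, hcon.2.2.1 h, hcon.2.2.2 h]
    -- `P` itself disappears, since it does not occur in `u`.
    by_cases hQP : Q = P
    · subst hQP
      simp [hu0, coeff_sp] at hy
    · simp [hu0, hcon.1 hQP, coeff_sp_of_ne (Ne.symm hQP)] at hy
  have hlt : ∀ Q : SpecialPoset, Q.weight < P.weight → 4 * 4 ^ Q.weight ≤ 4 ^ P.weight := by
    intro Q h
    rw [← pow_succ']
    exact Nat.pow_le_pow_right (by norm_num) h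
  have hins : ∀ (Q : SpecialPoset) (s : Finset SpecialPoset),
      ∑ R ∈ insert Q s, 4 ^ R.weight ≤ 4 ^ Q.weight + ∑ R ∈ s, 4 ^ R.weight := by
    intro Q s
    by_cases h : Q ∈ s
    · rw [Finset.insert_eq_of_mem h]
      exact Nat.le_add_left _ _
    · rw [Finset.sum_insert h]
  have hthree : ∑ Q ∈ {Q₁, Q₂, Q₃}, 4 ^ Q.weight ≤
      4 ^ Q₁.weight + (4 ^ Q₂.weight + 4 ^ Q₃.weight) := by
    refine (hins _ _).trans (Nat.add_le_add_left ((hins _ _).trans ?_) _)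
    rw [Finset.sum_singleton]
  have hx := Finset.sum_erase_add (terms x) (fun Q => 4 ^ Q.weight) (mem_terms.2 hP)
  have hu := Finset.sum_union_inter (s₁ := (terms x).erase P) (s₂ := {Q₁, Q₂, Q₃})
    (f := fun Q => 4 ^ Q.weight)
  have hle : totalWeight (x - coeff K x P • sp K P + coeff K x P • u) ≤ _ :=
    Finset.sum_le_sum_of_subset (f := fun Q : SpecialPoset => 4 ^ Q.weight) hsub
  have hpos : 0 < 4 ^ P.weight := by positivity
  have := hlt _ h1
  have := hlt _ h2
  have := hlt _ h3
  unfold totalWeight at hle ⊢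
  omega

theorem rewrite_wellFounded : WellFounded fun y x : hSP K => Rewrite K x y :=
  Subrelation.wf (fun h => Rewrite.totalWeight_lt h) (measure (totalWeight (K := K))).wf

/-- A transformation applies to `P` exactly when `P` has an inverted edge or an element covering two
others, i.e. when `P` is not a heap-ordered forest. -/
theorem exists_localRule_iff {P : SpecialPoset} :
    (∃ u, LocalRule K P u) ↔ P ∉ heapOrderedForests.toSubmonoid := by
  change _ ↔ ¬ (P.IsHeapOrdered ∧ P.IsForest)
  constructor
  · rintro ⟨u, h⟩ ⟨hP, hP'⟩
    cases h with
    | first i j hij h => exact isHeapOrdered_iff.1 hP i j hij h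
    | second i j k hij hjk hi hj => exact (isForest_iff hP).1 hP' i j k hij hi hj
  · intro h
    by_cases hP : P.IsHeapOrdered
    · have hf : ¬ P.IsForest := fun hf => h ⟨hP, hf⟩
      rw [isForest_iff hP] at hf
      push Not at hf
      obtain ⟨i, j, k, hij, hi, hj⟩ := hf
      exact ⟨_, .second i j k hij (lt_of_le_of_ne (hP _ _ (hasse_le hj)) hj.1) hi hj⟩
    · rw [isHeapOrdered_iff] at hP
      push Not at hP
      obtain ⟨i, j, hij, h⟩ := hP
      exact ⟨_, .first i j hij h⟩

theorem coeff_hofIncl (z : hHOF K) {P : SpecialPoset} (hP : P ∉ heapOrderedForests.toSubmonoid) :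
    coeff K (hofIncl K z) P = 0 := by
  have h : coeffLin K P ∘ₗ (hofIncl K : hHOF K →ₗ[K] hSP K) = 0 :=
    PosetHopf.linearMap_ext fun Q => by
      refine (congrArg (coeffLin K P) (hofIncl_of K Q)).trans (coeff_sp_of_ne ?_)
      rintro rfl
      exact hP Q.2
  exact LinearMap.congr_fun h z

theorem irreducible_iff (x : hSP K) :
    (∀ y, ¬ Rewrite K x y) ↔ ∃ z : hHOF K, hofIncl K z = x := by
  constructor
  · intro h
    refine ⟨∑ P ∈ terms x, coeff K x P • PosetHopf.ofE heapOrderedForests K P, ?_⟩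
    conv_rhs => rw [eq_sum_terms x]
    rw [map_sum]
    refine Finset.sum_congr rfl fun P hP => ?_
    have hmem : P ∈ heapOrderedForests.toSubmonoid := by
      by_contra hcon
      obtain ⟨u, hu⟩ := exists_localRule_iff (K := K).2 hcon
      exact h _ ⟨P, u, hu, mem_terms.1 hP, rfl⟩
    rw [map_smul, PosetHopf.ofE_val ⟨P, hmem⟩, hofIncl_of]
  · rintro ⟨z, rfl⟩ y ⟨P, u, hu, hP, -⟩
    exact hP (coeff_hofIncl z (exists_localRule_iff.1 ⟨u, hu⟩))

theorem exists_reduction (x : hSP K) :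
    ∃ z : hHOF K, Relation.ReflTransGen (Rewrite K) x (hofIncl K z) := by
  induction x using rewrite_wellFounded.induction with
  | _ x ih =>
    by_cases h : ∃ y, Rewrite K x y
    · obtain ⟨y, hy⟩ := h
      obtain ⟨z, hz⟩ := ih y hy
      exact ⟨z, hz.head hy⟩
    · obtain ⟨z, rfl⟩ := (irreducible_iff x).1 (not_exists.1 h)
      exact ⟨z, .refl⟩

theorem Rewrite.partialRewrite {x y : hSP K} (h : Rewrite K x y) : PartialRewrite K x y := by
  obtain ⟨P, u, hu, -, rfl⟩ := h
  exact ⟨P, u, coeff K x P, x - coeff K x P • sp K P, hu, by abel, by abel⟩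

end Rewriting

/-! ### Linear extensions and the transformations -/

theorem mem_linearExtensions {P : SpecialPoset} {σ : Equiv.Perm (Fin P.card)} :
    σ ∈ linearExtensions P ↔ ∀ i j, P.le i j → i ≠ j → σ.symm i < σ.symm j := by
  simp [linearExtensions]

/-- The letters of the word of `σ` appear in the order prescribed by the pairs in `R`. -/
def Respects {n : ℕ} (σ : Equiv.Perm (Fin n)) (R : Set (Fin n × Fin n)) : Prop :=
  ∀ e ∈ R, e.1 ≠ e.2 → σ.symm e.1 < σ.symm e.2

theorem respects_insert {n : ℕ} {σ : Equiv.Perm (Fin n)} {R : Set (Fin n × Fin n)}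
    {i j : Fin n} (hij : i ≠ j) :
    Respects σ (insert (i, j) R) ↔ σ.symm i < σ.symm j ∧ Respects σ R := by
  simp only [Respects, Set.forall_mem_insert, ne_eq, hij, not_false_eq_true, forall_const]

theorem mem_linearExtensions_generate {n : ℕ} {R : Set (Fin n × Fin n)} (h : Acyclic R)
    {σ : Equiv.Perm (Fin n)} : σ ∈ linearExtensions (generate R h) ↔ Respects σ R := by
  refine (mem_linearExtensions (P := generate R h)).trans ?_
  constructor
  · exact fun hσ e he hne => hσ e.1 e.2 (Relation.ReflTransGen.single he) hne
  · intro hR i j hij hne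
    have key : σ.symm i ≤ σ.symm j := by
      clear hne
      change Path R i j at hij
      induction hij with
      | refl => exact le_rfl
      | @tail b c _ hbc ih =>
        by_cases hb : b = c
        · exact hb ▸ ih
        · exact ih.trans (hR _ hbc hb).le
    exact lt_of_le_of_ne key fun heq => hne (σ.symm.injective heq)

theorem generate_hasse (P : SpecialPoset) :
    generate P.hasse (acyclic_of_subset subset_rfl) = P :=
  ext_of_iso (OrderIso.refl _) fun _ _ => le_iff_path_hasse.symm

section Theta

variable {K : Type*} [Field K]

theorem theta_sp (P : SpecialPoset) :
    theta K (sp K P) = ∑ σ ∈ linearExtensions P, FQSym.basis K σ :=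
  PosetHopf.linearLift_of _ _

open Classical in
theorem theta_sp_generate {n : ℕ} {R : Set (Fin n × Fin n)} (h : Acyclic R) :
    theta K (sp K (generate R h)) =
      ∑ σ : Equiv.Perm (Fin n), if Respects σ R then FQSym.basis K σ else 0 := by
  have hs : (show Finset (Equiv.Perm (Fin n)) from linearExtensions (generate R h)) =
      (Finset.univ : Finset (Equiv.Perm (Fin n))).filter fun σ => Respects σ R := by
    refine Finset.ext fun σ => (mem_linearExtensions_generate h).trans ?_
    simp
  rw [theta_sp, ← Finset.sum_filter]
  exact congrArg (fun s : Finset (Equiv.Perm (Fin n)) => ∑ σ ∈ s, FQSym.basis K σ) hs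

open Classical in
theorem theta_sp_hasse (P : SpecialPoset) : theta K (sp K P) =
    ∑ σ : Equiv.Perm (Fin P.card), if Respects σ P.hasse then FQSym.basis K σ else 0 := by
  conv_lhs => rw [← generate_hasse P]
  exact theta_sp_generate _

/-- The two transformations do not change the sum of the linear extensions. -/
theorem LocalRule.theta_eq {P : SpecialPoset} {u : hSP K} (h : LocalRule K P u) :
    theta K u = theta K (sp K P) := by
  classical
  cases h with
  | first i j hij h =>
    have hP : P.hasse = insert (j, i) (P.hasse \ {(j, i)}) := by
      rw [Set.insert_sdiff_singleton, Set.insert_eq_of_mem h]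
    rw [map_sub, theta_sp_generate, theta_sp_generate, theta_sp_hasse, ← Finset.sum_sub_distrib]
    refine Finset.sum_congr rfl fun σ _ => ?_
    have h1 : Respects σ P.hasse ↔ σ.symm j < σ.symm i ∧ Respects σ (P.hasse \ {(j, i)}) := by
      conv_lhs => rw [hP]
      exact respects_insert hij.ne'
    simp only [h1, respects_insert hij.ne]
    by_cases hA : Respects σ (P.hasse \ {(j, i)})
    · rcases lt_or_gt_of_ne fun heq => hij.ne (σ.symm.injective heq) with hlt | hlt <;>
        simp [hA, hlt, hlt.not_gt]
    · simp [hA]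
  | second i j k hij hjk hi hj =>
    have hik := hij.trans hjk
    have hD : P.hasse \ {(j, k)} = insert (i, k) (P.hasse \ {(j, k), (i, k)}) := by
      ext e
      simp only [Set.mem_sdiff, Set.mem_singleton_iff, Set.mem_insert_iff]
      have : (i, k) ≠ (j, k) := fun h => hij.ne (Prod.mk.inj h).1
      by_cases he : e = (i, k)
      · subst he
        simp [hi, this]
      · simp [he]
    have hP : P.hasse = insert (j, k) (P.hasse \ {(j, k)}) := by
      rw [Set.insert_sdiff_singleton, Set.insert_eq_of_mem hj]
    have hC : P.hasse \ {(j, k), (i, k)} ∪ {(i, j), (j, k)} =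
        insert (i, j) (insert (j, k) (P.hasse \ {(j, k), (i, k)})) := by
      rw [Set.union_comm, Set.insert_union, Set.singleton_union]
    rw [map_add, map_sub, theta_sp_generate, theta_sp_generate, theta_sp_generate,
      theta_sp_hasse, ← Finset.sum_sub_distrib, ← Finset.sum_add_distrib]
    refine Finset.sum_congr rfl fun σ _ => ?_
    have h1 : Respects σ (P.hasse \ {(j, k)}) ↔
        σ.symm i < σ.symm k ∧ Respects σ (P.hasse \ {(j, k), (i, k)}) := by
      rw [hD]
      exact respects_insert hik.ne
    have h2 : Respects σ P.hasse ↔ σ.symm j < σ.symm k ∧ Respects σ (P.hasse \ {(j, k)}) := by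
      conv_lhs => rw [hP]
      exact respects_insert hjk.ne
    rw [hC]
    simp only [h2, h1, respects_insert hij.ne, respects_insert hjk.ne]
    -- If `i` comes before `k`, then `j` fails to come before `k` only if `i, k, j` appear in this
    -- order: this is the case removed by the difference of the last two terms.
    by_cases hA : Respects σ (P.hasse \ {(j, k), (i, k)})
    · by_cases hik' : σ.symm i < σ.symm k
      · by_cases hjk' : σ.symm j < σ.symm k
        · simp [hA, hik', hjk']
        · have : σ.symm i < σ.symm j := hik'.trans_le (not_lt.1 hjk')
          simp [hA, hik', hjk', this]
      · have : ¬ (σ.symm i < σ.symm j ∧ σ.symm j < σ.symm k) := fun h => hik' (h.1.trans h.2)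
        simp only [hA, hik', and_true, and_false, if_false, this, sub_zero, add_zero]
    · simp [hA]

theorem PartialRewrite.theta_eq {x y : hSP K} (h : PartialRewrite K x y) :
    theta K y = theta K x := by
  obtain ⟨P, u, c, r, hu, rfl, rfl⟩ := h
  rw [map_add, map_add, map_smul, map_smul, hu.theta_eq]

theorem theta_eq_of_reflTransGen {x y : hSP K}
    (h : Relation.ReflTransGen (PartialRewrite K) x y) : theta K y = theta K x := by
  induction h with
  | refl => rfl
  | tail _ h ih => exact h.theta_eq.trans ih

/-- The chain whose only linear extension is `σ`. -/
def chain {n : ℕ} (σ : Equiv.Perm (Fin n)) : SpecialPoset where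
  card := n
  le i j := σ.symm i ≤ σ.symm j
  isPartialOrder :=
    { refl := fun _ => le_rfl
      trans := fun _ _ _ => le_trans
      antisymm := fun _ _ h h' => σ.symm.injective (le_antisymm h h') }

theorem linearExtensions_chain {n : ℕ} (σ : Equiv.Perm (Fin n)) :
    linearExtensions (chain σ) = {σ} := by
  ext τ
  refine (mem_linearExtensions (P := chain σ)).trans
    (Iff.trans ?_ ((FQSym.compat_id σ τ).trans Finset.mem_singleton.symm))
  constructor
  · intro h a b hab
    exact h (σ a) (σ b) (by simpa [chain] using hab.le) fun heq => hab.ne (σ.injective heq)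
  · intro h i j hij hne
    have hlt : σ.symm i < σ.symm j := lt_of_le_of_ne hij fun heq => hne (σ.symm.injective heq)
    exact (congrArg₂ (fun a b : Fin n => τ.symm a < τ.symm b) (σ.apply_symm_apply i)
      (σ.apply_symm_apply j)).mp (h hlt)

/-- Every permutation is the image of a chain, which is in general not heap-ordered. -/
theorem theta_surjective : Function.Surjective (theta K) := by
  intro y
  induction y using FQSym.induction_basis with
  | h0 => exact ⟨0, map_zero _⟩
  | hadd y y' h h' =>
    obtain ⟨x, rfl⟩ := h
    obtain ⟨x', rfl⟩ := h'
    exact ⟨x + x', map_add _ _ _⟩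
  | hs a n σ =>
    refine ⟨a • sp K (chain σ), ?_⟩
    rw [map_smul, theta_sp, linearExtensions_chain]
    exact congrArg _ (Finset.sum_singleton _ _)

theorem exists_theta_hofIncl_eq (x : hSP K) :
    ∃ z : hHOF K, theta K (hofIncl K z) = theta K x := by
  obtain ⟨z, hz⟩ := exists_reduction x
  exact ⟨z, theta_eq_of_reflTransGen
    (Relation.ReflTransGen.mono (fun _ _ => Rewrite.partialRewrite) _ _ hz)⟩

theorem theta_hofIncl_surjective : Function.Surjective fun z => theta K (hofIncl K z) := by
  intro y
  obtain ⟨x, rfl⟩ := theta_surjective y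
  exact exists_theta_hofIncl_eq x

end Theta

/-! ### The pairing -/

section Pairing

variable (K : Type*) [Field K]

open Classical in
/-- The pairing of `FQSym` for which the dual basis is given by the inverses of the
permutations. -/
noncomputable def invPairing : FQSym K →ₗ[K] FQSym K →ₗ[K] K :=
  FQSym.linearLift fun m σ => FQSym.linearLift fun n τ =>
    if (⟨m, σ⁻¹⟩ : Permutations) = ⟨n, τ⟩ then 1 else 0

/-- The pictures between `P` and `Q` are the linear extensions of `Q` whose inverse is a linear
extension of `P`, so that the pairing only depends on the linear extensions. -/
theorem pairing_eq_invPairing (x y : hSP K) :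
    pairing K x y = invPairing K (theta K x) (theta K y) := by
  classical
  have h : pairing K = (invPairing K).compl₁₂ (theta K) (theta K) := by
    refine PosetHopf.linearMap_ext fun ⟨P, hP⟩ => PosetHopf.linearMap_ext fun ⟨Q, hQ⟩ => ?_
    rw [pairing, PosetHopf.linearLift_of, PosetHopf.linearLift_of]
    change _ = invPairing K (theta K (sp K P)) (theta K (sp K Q))
    rw [theta_sp, theta_sp]
    simp only [map_sum, LinearMap.sum_apply, invPairing, FQSym.linearLift_basis]
    by_cases hc : P.card = Q.card
    · obtain ⟨n, le, hle⟩ := P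
      obtain ⟨m, le', hle'⟩ := Q
      simp only at hc
      subst hc
      simp only [Sigma.mk.injEq, heq_eq_eq, true_and]
      rw [Finset.sum_comm]
      simp only [Finset.sum_ite_eq, ← Finset.sum_filter]
      rw [Finset.sum_const, nsmul_eq_mul, mul_one, ← Nat.card_eq_finsetCard]
      congr 1
      refine Nat.card_congr ((Equiv.inv (Equiv.Perm (Fin n))).subtypeEquiv fun f => ?_)
      simp only [Finset.mem_filter, Equiv.inv_apply, inv_inv]
      constructor
      · intro hf
        refine ⟨mem_linearExtensions.2 fun i j hij hne =>
          lt_of_le_of_ne ((hf i j).1 hij) (f.injective.ne hne),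
          mem_linearExtensions.2 fun i j hij hne =>
          lt_of_le_of_ne ((hf _ _).2 ?_) (f.symm.injective.ne hne)⟩
        rwa [f.apply_symm_apply, f.apply_symm_apply]
      · rintro ⟨h1, h2⟩ i j
        rw [mem_linearExtensions] at h1 h2
        constructor
        · intro hij
          by_cases hne : i = j
          · rw [hne]
          · exact (h1 i j hij hne).le
        · intro hij
          by_cases hne : i = j
          · rw [hne]
          · exact ((f.symm_apply_apply i).symm.trans_lt ((h2 _ _ hij (f.injective.ne hne)).trans_eq
              (f.symm_apply_apply j))).le
    · have : IsEmpty (Picture P Q) :=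
        ⟨fun f => hc (by simpa using Fintype.card_congr f.1)⟩
      simp [hc]
  rw [h]
  rfl

end Pairing

/-! ### Linear extensions and products -/

section ThetaMul

variable {K : Type*} [Field K]

theorem FQSym.basis_mul_basis {k l : ℕ} (σ : Equiv.Perm (Fin k)) (τ : Equiv.Perm (Fin l)) :
    basis K σ * basis K τ = mulBasis σ τ :=
  mulLin_basis σ τ

theorem FQSym.Compat.symm_lt_symm_iff {k n : ℕ} {f : Fin k → Fin n} {σ : Equiv.Perm (Fin k)}
    {ρ : Equiv.Perm (Fin n)} (h : Compat f σ ρ) {x y : Fin k} :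
    σ.symm x < σ.symm y ↔ ρ.symm (f x) < ρ.symm (f y) := by
  have := h.lt_iff_lt (a := σ.symm x) (b := σ.symm y)
  simpa using this.symm

/-- The linear extensions of `PQ` are the shuffles of those of `P` and `Q`. -/
theorem mem_linearExtensions_mul {P Q : SpecialPoset} {σ : Equiv.Perm (Fin P.card)}
    {τ : Equiv.Perm (Fin Q.card)} {ρ : Equiv.Perm (Fin (P * Q).card)}
    (hσ : FQSym.Compat (inl P Q) σ ρ) (hτ : FQSym.Compat (inr P Q) τ ρ) :
    ρ ∈ linearExtensions (P * Q) ↔ σ ∈ linearExtensions P ∧ τ ∈ linearExtensions Q := by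
  simp only [mem_linearExtensions]
  constructor
  · intro h
    exact ⟨fun i j hij hne =>
        hσ.symm_lt_symm_iff.2 (h _ _ (by simpa using hij) (by simpa using hne)),
      fun i j hij hne => hτ.symm_lt_symm_iff.2 (h _ _ (by simpa using hij) (by simpa using hne))⟩
  · rintro ⟨h1, h2⟩ x y hxy hne
    rcases mul_cases P Q x with ⟨x, rfl⟩ | ⟨x, rfl⟩ <;>
      rcases mul_cases P Q y with ⟨y, rfl⟩ | ⟨y, rfl⟩ <;> simp at hxy hne
    · exact hσ.symm_lt_symm_iff.1 (h1 _ _ hxy hne)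
    · exact hτ.symm_lt_symm_iff.1 (h2 _ _ hxy hne)

theorem sum_linearExtensions_mul (P Q : SpecialPoset) :
    ∑ ρ ∈ linearExtensions (P * Q), FQSym.basis K ρ =
      (∑ σ ∈ linearExtensions P, FQSym.basis K σ) * ∑ τ ∈ linearExtensions Q, FQSym.basis K τ := by
  classical
  simp only [Finset.sum_mul_sum, FQSym.basis_mul_basis, FQSym.mulBasis_eq]
  simp only [Finset.sum_comm (t := (Finset.univ : Finset (Equiv.Perm (Fin (P.card + Q.card)))))]
  have hfilter : linearExtensions (P * Q) = Finset.univ.filter (· ∈ linearExtensions (P * Q)) := by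
    simp
  rw [hfilter, Finset.sum_filter]
  refine Finset.sum_congr rfl fun ρ _ => ?_
  obtain ⟨σ, hσ⟩ := FQSym.exists_compat (inl P Q) (fun _ _ => (inl_inj _ _).1) ρ
  obtain ⟨τ, hτ⟩ := FQSym.exists_compat (inr P Q) (fun _ _ => (inr_inj _ _).1) ρ
  have h : ∀ σ' τ', (FQSym.Compat (Fin.castAdd Q.card) σ' ρ ∧
      FQSym.Compat (Fin.natAdd P.card) τ' ρ) ↔ σ' = σ ∧ τ' = τ :=
    fun σ' τ' => and_congr (hσ σ') (hτ τ')
  simp only [h, ite_and, mem_linearExtensions_mul ((hσ σ).2 rfl) ((hτ τ).2 rfl)]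
  simp

theorem linearExtensions_one : linearExtensions 1 = {(1 : Equiv.Perm (Fin 0))} := by
  ext σ
  rw [mem_linearExtensions, Finset.mem_singleton]
  exact ⟨fun _ => Subsingleton.elim (α := Equiv.Perm (Fin 0)) _ _, fun _ i => i.elim0⟩

theorem sum_linearExtensions_one :
    ∑ σ ∈ linearExtensions 1, FQSym.basis K σ = 1 := by
  rw [linearExtensions_one]
  exact Finset.sum_singleton _ _

variable (K) in
/-- The map `Θ`, as an algebra morphism. -/
noncomputable def thetaAlg : hSP K →ₐ[K] FQSym K :=
  PosetHopf.algLift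
    { toFun := fun P => ∑ σ ∈ linearExtensions P.1, FQSym.basis K σ
      map_one' := sum_linearExtensions_one
      map_mul' := fun P Q => sum_linearExtensions_mul P.1 Q.1 }

theorem thetaAlg_of (P : allSpecialPosets.Elem) :
    thetaAlg K (PosetHopf.of K P) = ∑ σ ∈ linearExtensions P.1, FQSym.basis K σ :=
  PosetHopf.algLift_of _ P

theorem thetaAlg_toLinearMap : (thetaAlg K).toLinearMap = theta K :=
  PosetHopf.linearMap_ext fun P =>
    (thetaAlg_of P).trans (PosetHopf.linearLift_of
      (fun P : allSpecialPosets.Elem => ∑ σ ∈ linearExtensions P.1, FQSym.basis K σ) P).symm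

end ThetaMul

/-! ### Linear extensions and coproducts -/

section ThetaComul

variable {K : Type*} [Field K]

/-- Standardization does not see a composition with an increasing map; the size of the word is
allowed to be only propositionally the expected one. -/
theorem FQSym.basis_standardize {m c n : ℕ} (h : m = c) (w : Fin m → Fin n) (f : Fin c → Fin n)
    (hf : StrictMono f) (α : Equiv.Perm (Fin c)) (hw : ∀ i, w i = f (α (Fin.cast h i))) :
    basis K (standardize w) = basis K α := by
  subst h
  have hsort : Tuple.sort w = α⁻¹ := by
    have h1 : Monotone (w ∘ ⇑α⁻¹) := by
      intro a b hab
      simpa [hw] using hf.monotone hab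
    have hinj : Function.Injective w := by
      intro a b hab
      simpa [hw, hf.injective.eq_iff] using hab
    have := Tuple.unique_monotone (Tuple.monotone_sort w) h1
    ext i
    exact congrArg Fin.val (hinj (congrFun this i))
  rw [standardize, hsort, inv_inv]

/-- The bijection between the disjoint union of the two pieces of a cut of `P` and `P`. -/
noncomputable def inclEquiv (P : SpecialPoset) (I : Finset (Fin P.card)) :
    Fin (P.restrict Iᶜ).card ⊕ Fin (P.restrict I).card ≃ Fin P.card :=
  Equiv.ofBijective (Sum.elim (incl P Iᶜ) (incl P I)) <| by
    constructor
    · refine incl_strictMono.injective.sumElim incl_strictMono.injective fun a b hab => ?_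
      exact Finset.mem_compl.1 (incl_mem a) (hab ▸ incl_mem b)
    · intro x
      by_cases hx : x ∈ I
      · obtain ⟨i, rfl⟩ := exists_incl hx
        exact ⟨Sum.inr i, rfl⟩
      · obtain ⟨i, rfl⟩ := exists_incl (Finset.mem_compl.2 hx)
        exact ⟨Sum.inl i, rfl⟩

theorem card_restrict_add (P : SpecialPoset) (I : Finset (Fin P.card)) :
    (P.restrict Iᶜ).card + (P.restrict I).card = P.card := by
  simpa using Fintype.card_congr (inclEquiv P I)

/-- The concatenation of a word in the complement of `I` and of a word in `I`. -/
noncomputable def concat (P : SpecialPoset) (I : Finset (Fin P.card))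
    (α : Equiv.Perm (Fin (P.restrict Iᶜ).card)) (β : Equiv.Perm (Fin (P.restrict I).card)) :
    Equiv.Perm (Fin P.card) :=
  (finCongr (card_restrict_add P I).symm).trans
    (finSumFinEquiv.symm.trans ((Equiv.sumCongr α β).trans (inclEquiv P I)))

section
variable {P : SpecialPoset} {I : Finset (Fin P.card)}
  {α : Equiv.Perm (Fin (P.restrict Iᶜ).card)} {β : Equiv.Perm (Fin (P.restrict I).card)}

theorem concat_castAdd (a : Fin (P.restrict Iᶜ).card) :
    concat P I α β (Fin.cast (card_restrict_add P I) (Fin.castAdd _ a)) = incl P Iᶜ (α a) := by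
  simp only [concat, Equiv.trans_apply, finCongr_apply, Fin.cast_cast, Fin.cast_eq_self,
    finSumFinEquiv_symm_apply_castAdd]
  rfl

theorem concat_natAdd (b : Fin (P.restrict I).card) :
    concat P I α β (Fin.cast (card_restrict_add P I) (Fin.natAdd _ b)) = incl P I (β b) := by
  simp only [concat, Equiv.trans_apply, finCongr_apply, Fin.cast_cast, Fin.cast_eq_self,
    finSumFinEquiv_symm_apply_natAdd]
  rfl

theorem eq_castAdd_or_natAdd (P : SpecialPoset) (I : Finset (Fin P.card)) (x : Fin P.card) :
    (∃ a, x = Fin.cast (card_restrict_add P I) (Fin.castAdd _ a)) ∨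
      ∃ b, x = Fin.cast (card_restrict_add P I) (Fin.natAdd _ b) := by
  have : ∃ y, x = Fin.cast (card_restrict_add P I) y :=
    ⟨Fin.cast (card_restrict_add P I).symm x, rfl⟩
  obtain ⟨y, rfl⟩ := this
  refine Fin.addCases (fun a => ?_) (fun b => ?_) y
  · exact Or.inl ⟨a, rfl⟩
  · exact Or.inr ⟨b, rfl⟩

theorem concat_mem_iff (x : Fin P.card) :
    concat P I α β x ∈ I ↔ (P.restrict Iᶜ).card ≤ x := by
  rcases eq_castAdd_or_natAdd P I x with ⟨a, rfl⟩ | ⟨b, rfl⟩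
  · rw [concat_castAdd]
    refine iff_of_false (Finset.mem_compl.1 (incl_mem _)) ?_
    simp
  · rw [concat_natAdd]
    exact iff_of_true (incl_mem _) (by simp)

theorem concat_mem_linearExtensions (hI : I ∈ P.ideals) :
    concat P I α β ∈ linearExtensions P ↔
      α ∈ linearExtensions (P.restrict Iᶜ) ∧ β ∈ linearExtensions (P.restrict I) := by
  have hmem : ∀ (Q : SpecialPoset) (σ : Equiv.Perm (Fin Q.card)), σ ∈ linearExtensions Q ↔
      ∀ a b, Q.le (σ a) (σ b) → a ≠ b → a < b := by
    intro Q σ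
    rw [mem_linearExtensions, ← σ.forall_congr_right]
    refine forall_congr' fun a => ?_
    rw [← σ.forall_congr_right]
    simp
  simp only [hmem]
  constructor
  · intro h
    constructor
    · intro a b hab hne
      have := h (Fin.cast (card_restrict_add P I) (Fin.castAdd _ a))
        (Fin.cast (card_restrict_add P I) (Fin.castAdd _ b))
        (by rw [concat_castAdd, concat_castAdd]; exact hab) fun heq => hne (by simpa [Fin.ext_iff] using heq)
      exact this
    · intro a b hab hne
      have := h (Fin.cast (card_restrict_add P I) (Fin.natAdd _ a))
        (Fin.cast (card_restrict_add P I) (Fin.natAdd _ b))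
        (by rw [concat_natAdd, concat_natAdd]; exact hab) fun heq => hne (by simpa [Fin.ext_iff] using heq)
      exact Nat.lt_of_add_lt_add_left this
  · rintro ⟨h1, h2⟩ x y hxy hne
    rcases eq_castAdd_or_natAdd P I x with ⟨a, rfl⟩ | ⟨a, rfl⟩ <;>
      rcases eq_castAdd_or_natAdd P I y with ⟨b, rfl⟩ | ⟨b, rfl⟩ <;>
      simp only [concat_castAdd, concat_natAdd] at hxy
    · exact h1 a b hxy fun h => hne (by rw [h])
    · simp only [Fin.lt_def, Fin.val_cast, Fin.val_castAdd, Fin.val_natAdd]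
      omega
    · exact absurd (mem_ideals.1 hI _ (incl_mem _) _ hxy) (Finset.mem_compl.1 (incl_mem _))
    · have := h2 a b hxy fun h => hne (by rw [h])
      exact Nat.add_lt_add_left this _

end

/-- Cutting the word of a linear extension of `P` amounts to choosing an ideal `I` of `P`, made of the
letters after the cut, and a linear extension of each of `P \ I` and `I`. -/
theorem sum_comulBasis_linearExtensions (P : SpecialPoset) :
    ∑ I ∈ P.ideals, ∑ α ∈ linearExtensions (P.restrict Iᶜ), ∑ β ∈ linearExtensions (P.restrict I),
        FQSym.basis K α ⊗ₜ[K] FQSym.basis K β =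
      ∑ σ ∈ linearExtensions P, FQSym.comulBasis σ := by
  simp only [FQSym.comulBasis]
  simp only [← Finset.sum_product', Finset.sum_sigma']
  refine Finset.sum_bij
    (fun p _ => ⟨concat P p.1 p.2.1 p.2.2,
      ⟨(P.restrict p.1ᶜ).card, by have := card_restrict_add P p.1; omega⟩⟩) ?_ ?_ ?_ ?_
  · rintro ⟨I, α, β⟩ h
    simp only [Finset.mem_sigma, Finset.mem_product] at h
    simpa using (concat_mem_linearExtensions h.1).2 h.2
  · rintro ⟨I, α, β⟩ _ ⟨J, γ, δ⟩ _ h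
    simp only [Fin.mk.injEq, Prod.mk.injEq] at h
    obtain ⟨h1, h2⟩ := h
    -- The ideal consists of the letters after the cut.
    obtain rfl : I = J := by
      ext y
      obtain ⟨x, rfl⟩ := (concat P I α β).surjective y
      rw [concat_mem_iff, h2, ← concat_mem_iff (α := γ) (β := δ), h1]
    have hα : α = γ := by
      ext a
      have := congrArg (fun σ => σ (Fin.cast (card_restrict_add P I) (Fin.castAdd _ a))) h1
      simp only [concat_castAdd] at this
      rw [incl_strictMono.injective this]
    have hβ : β = δ := by
      ext b
      have := congrArg (fun σ => σ (Fin.cast (card_restrict_add P I) (Fin.natAdd _ b))) h1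
      simp only [concat_natAdd] at this
      rw [incl_strictMono.injective this]
    rw [hα, hβ]
  · rintro ⟨σ, k, hk⟩ h
    simp only [Finset.mem_product, Finset.mem_univ, and_true] at h
    let I : Finset (Fin P.card) := Finset.univ.filter fun x => k ≤ (σ.symm x : ℕ)
    have hmem : ∀ x, σ x ∈ I ↔ k ≤ x := fun x => by simp [I]
    have hcard : (P.restrict Iᶜ).card = k := by
      have himg : Iᶜ = (Finset.univ.filter fun x : Fin P.card => (x : ℕ) < k).image σ := by
        ext y
        obtain ⟨x, rfl⟩ := σ.surjective y
        simp [hmem]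
      rw [card_restrict, himg, Finset.card_image_of_injective _ σ.injective,
        Fin.card_filter_val_lt]
      omega
    have hI : I ∈ P.ideals := by
      rw [mem_ideals]
      intro x hx y hxy
      obtain ⟨x, rfl⟩ := σ.surjective x
      obtain ⟨y, rfl⟩ := σ.surjective y
      rw [hmem] at hx ⊢
      by_cases hne : σ x = σ y
      · rwa [← σ.injective hne]
      · have := mem_linearExtensions.1 h _ _ hxy hne
        simp only [Equiv.symm_apply_apply, Fin.lt_def] at this
        omega
    have hα : ∀ a : Fin (P.restrict Iᶜ).card, ∃ i, incl P Iᶜ i =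
        σ (Fin.cast (card_restrict_add P I) (Fin.castAdd _ a)) := fun a =>
      exists_incl (by
        rw [Finset.mem_compl, hmem]
        have := a.2
        simp only [Fin.val_cast, Fin.val_castAdd]
        omega)
    have hβ : ∀ b : Fin (P.restrict I).card, ∃ i, incl P I i =
        σ (Fin.cast (card_restrict_add P I) (Fin.natAdd _ b)) := fun b =>
      exists_incl (by
        rw [hmem]
        simp only [Fin.val_cast, Fin.val_natAdd]
        omega)
    choose α hα using hα
    choose β hβ using hβ
    have hαi : Function.Injective α := fun a b hab => by
      have := (hα a).symm.trans ((congrArg _ hab).trans (hα b))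
      simpa [Fin.ext_iff] using σ.injective this
    have hβi : Function.Injective β := fun a b hab => by
      have := (hβ a).symm.trans ((congrArg _ hab).trans (hβ b))
      simpa [Fin.ext_iff] using σ.injective this
    let α' := Equiv.ofBijective α (Finite.injective_iff_bijective.1 hαi)
    let β' := Equiv.ofBijective β (Finite.injective_iff_bijective.1 hβi)
    have hc : concat P I α' β' = σ := by
      ext1 x
      rcases eq_castAdd_or_natAdd P I x with ⟨a, rfl⟩ | ⟨b, rfl⟩
      · rw [concat_castAdd]
        exact hα a
      · rw [concat_natAdd]
        exact hβ b
    refine ⟨⟨I, α', β'⟩, ?_, ?_⟩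
    · simp only [Finset.mem_sigma, Finset.mem_product]
      exact ⟨hI, (concat_mem_linearExtensions hI).1 (hc ▸ h)⟩
    · simp only [Prod.mk.injEq, Fin.mk.injEq]
      exact ⟨hc, hcard⟩
  · rintro ⟨I, α, β⟩ _
    have hk : P.card - (P.restrict Iᶜ).card = (P.restrict I).card := by
      have := card_restrict_add P I
      omega
    congr 1
    · refine (FQSym.basis_standardize rfl _ (incl P Iᶜ) incl_strictMono α fun i => ?_).symm
      exact concat_castAdd i
    · refine (FQSym.basis_standardize hk _ (incl P I) incl_strictMono β fun i => ?_).symm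
      refine Eq.trans ?_ (concat_natAdd (α := α) (Fin.cast hk i))
      exact congrArg _ (Fin.ext rfl)

variable (K) in
/-- The map `Θ`, as a bialgebra morphism. -/
noncomputable def thetaBialg : hSP K →ₐc[K] FQSym K :=
  { thetaAlg K with
    map_smul' := map_smul (thetaAlg K)
    counit_comp := by
      refine PosetHopf.linearMap_ext fun P => ?_
      refine Eq.trans ?_ (PosetHopf.counit_of P).symm
      refine (congrArg (Coalgebra.counit (R := K)) (thetaAlg_of (K := K) P)).trans ?_
      change FQSym.linearLift (K := K) _ (∑ σ ∈ linearExtensions P.1, FQSym.basis K σ) = _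
      simp only [map_sum, FQSym.linearLift_basis]
      split_ifs with h
      · obtain ⟨P, hP⟩ := P
        obtain rfl : P = 1 := eq_one_of_card h
        have := congrArg (Finset.sum · fun _ => (1 : K)) linearExtensions_one
        simpa using this
      · simp
    map_comp_comul := by
      refine PosetHopf.linearMap_ext fun P => ?_
      refine (congrArg (TensorProduct.map (thetaAlg K).toLinearMap (thetaAlg K).toLinearMap)
        (PosetHopf.comul_of P)).trans ?_
      refine Eq.trans ?_ (congrArg (Coalgebra.comul (R := K)) (thetaAlg_of P)).symm
      change _ = FQSym.linearLift (K := K) _ (∑ σ ∈ linearExtensions P.1, FQSym.basis K σ)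
      simp only [map_sum, FQSym.linearLift_basis]
      rw [← sum_comulBasis_linearExtensions, PosetHopf.comulBasis, map_sum]
      refine Finset.sum_congr rfl fun I _ => ?_
      rw [TensorProduct.map_tmul]
      refine (congrArg₂ (fun a b : FQSym K => a ⊗ₜ[K] b) (thetaAlg_of _)
        (thetaAlg_of _)).trans ?_
      change (∑ σ ∈ linearExtensions (P.1.restrict Iᶜ), FQSym.basis K σ) ⊗ₜ[K]
        (∑ σ ∈ linearExtensions (P.1.restrict I), FQSym.basis K σ) = _
      rw [TensorProduct.sum_tmul]
      simp only [TensorProduct.tmul_sum] }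

theorem thetaBialg_apply (x : hSP K) : thetaBialg K x = theta K x :=
  LinearMap.congr_fun thetaAlg_toLinearMap x

end ThetaComul

/-! ### Counting heap-ordered forests -/

open Classical in
/-- The parent of `j` in a heap-ordered forest `P`, i.e. the largest element strictly below `j`; by
convention a root is its own parent. -/
noncomputable def parent (P : SpecialPoset) (j : Fin P.card) : Fin P.card :=
  if h : (Finset.univ.filter fun i => P.le i j ∧ i ≠ j).Nonempty then
    (Finset.univ.filter fun i => P.le i j ∧ i ≠ j).max' h
  else j

theorem parent_le {P : SpecialPoset} (hP : P.IsHeapOrdered) (j : Fin P.card) :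
    parent P j ≤ j := by
  classical
  unfold parent
  split_ifs with h
  · refine Finset.max'_le _ _ _ fun i hi => ?_
    rw [Finset.mem_filter_univ] at hi
    exact hP _ _ hi.1
  · exact le_rfl

theorem le_iff_le_parent {P : SpecialPoset} (hP : P.IsHeapOrdered) (hP' : P.IsForest)
    {i j : Fin P.card} :
    P.le i j ↔ i = j ∨ parent P j ≠ j ∧ P.le i (parent P j) := by
  classical
  have hpar : parent P j ≠ j → P.le (parent P j) j := by
    intro hne
    unfold parent at hne ⊢
    split_ifs at hne ⊢ with h
    swap
    · exact absurd rfl hne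
    have := Finset.max'_mem _ h
    rw [Finset.mem_filter_univ] at this
    exact this.1
  constructor
  · intro hij
    by_cases hne : i = j
    · exact Or.inl hne
    have hmem : i ∈ (Finset.univ.filter fun i => P.le i j ∧ i ≠ j) := by
      simpa using ⟨hij, hne⟩
    have hn : (Finset.univ.filter fun i => P.le i j ∧ i ≠ j).Nonempty := ⟨i, hmem⟩
    have heq : parent P j = (Finset.univ.filter fun i => P.le i j ∧ i ≠ j).max' hn := dif_pos hn
    have hm := Finset.max'_mem _ hn
    rw [← heq] at hm
    rw [Finset.mem_filter_univ] at hm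
    refine Or.inr ⟨hm.2, ?_⟩
    have hle : i ≤ parent P j := heq ▸ Finset.le_max' _ _ hmem
    rcases hP' _ _ _ hij hm.1 with h | h
    · exact h
    · rw [le_antisymm hle (hP _ _ h)]
      exact refl_of P.le _
  · rintro (rfl | ⟨hne, h⟩)
    · exact refl_of P.le _
    · exact trans_of P.le h (hpar hne)

/-- A heap-ordered forest is determined by its parents. -/
theorem eq_of_parent_eq {P Q : SpecialPoset} (hP : P.IsHeapOrdered) (hP' : P.IsForest)
    (hQ : Q.IsHeapOrdered) (hQ' : Q.IsForest) (hc : P.card = Q.card)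
    (h : ∀ j, (parent P j : ℕ) = parent Q (Fin.cast hc j)) : P = Q := by
  refine ext_of_iso (Fin.castOrderIso hc) fun i j => ?_
  induction j using WellFoundedLT.induction with
  | ind j ih =>
    have hpar : Fin.cast hc (parent P j) = parent Q (Fin.cast hc j) := Fin.ext (h j)
    rw [le_iff_le_parent hP hP', le_iff_le_parent hQ hQ']
    simp only [Fin.castOrderIso_apply, ← hpar, Fin.cast_inj, ne_eq] at ih ⊢
    refine or_congr_right (and_congr_right fun hne => ?_)
    exact ih _ (lt_of_le_of_ne (parent_le hP j) hne)

/-- The heap-ordered forests with `n` elements. -/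
abbrev HOF (n : ℕ) : Type := {P : heapOrderedForests.Elem // P.1.card = n}

/-- The sequence of the parents in a heap-ordered forest with `n` elements. -/
noncomputable def parents {n : ℕ} (P : HOF n) (j : Fin n) : Fin (j + 1) :=
  ⟨parent P.1.1 (Fin.cast P.2.symm j), Nat.lt_succ_of_le (parent_le P.1.2.1 _)⟩

theorem parents_injective {n : ℕ} : Function.Injective (parents (n := n)) := by
  rintro ⟨⟨P, hP⟩, hc⟩ ⟨⟨Q, hQ⟩, hc'⟩ h
  subst hc
  refine Subtype.ext (Subtype.ext (eq_of_parent_eq hP.1 hP.2 hQ.1 hQ.2 hc'.symm fun j => ?_))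
  exact congrArg Fin.val (congrFun h j)

noncomputable instance (n : ℕ) : Fintype (HOF n) := Fintype.ofInjective _ parents_injective

theorem card_HOF_le (n : ℕ) : Fintype.card (HOF n) ≤ Fintype.card (Equiv.Perm (Fin n)) := by
  refine (Fintype.card_le_of_injective _ parents_injective).trans ?_
  rw [Fintype.card_pi, Fintype.card_perm, Fintype.card_fin]
  simp only [Fintype.card_fin]
  rw [Fin.prod_univ_eq_prod_range (fun i => i + 1) n, Finset.prod_range_add_one_eq_factorial]

/-! ### The isomorphism -/

section Iso

variable (K : Type*) [Field K]

/-- The coefficients of the permutations of `Fin n`. -/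
noncomputable def FQSym.component (n : ℕ) : FQSym K →ₗ[K] Equiv.Perm (Fin n) → K where
  toFun y σ := Finsupp.lapply (R := K) (M := K) (⟨n, σ⟩ : Permutations) y
  map_add' _ _ := rfl
  map_smul' _ _ := rfl

theorem FQSym.component_surjective (n : ℕ) : Function.Surjective (component K n) := by
  classical
  intro f
  refine ⟨∑ σ, f σ • basis K σ, ?_⟩
  ext τ
  rw [map_sum, Finset.sum_apply, Finset.sum_eq_single τ]
  · rw [map_smul, Pi.smul_apply, smul_eq_mul]
    refine (congrArg (f τ * ·) (Finsupp.single_eq_same)).trans (mul_one _)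
  · intro σ _ hne
    rw [map_smul, Pi.smul_apply, smul_eq_mul]
    refine (congrArg (f σ * ·) (Finsupp.single_eq_of_ne ?_)).trans (mul_zero _)
    intro h
    exact hne (eq_of_heq (Sigma.mk.inj h).2).symm
  · simp

theorem FQSym.component_basis_of_ne {m n : ℕ} (h : m ≠ n) (σ : Equiv.Perm (Fin m)) :
    component K n (basis K σ) = 0 := by
  ext τ
  exact Finsupp.single_eq_of_ne fun h' => h (Sigma.mk.inj h').1.symm

/-- The coefficients of the heap-ordered forests with `n` elements. -/
noncomputable def hofComponent (n : ℕ) : hHOF K →ₗ[K] HOF n → K where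
  toFun z P := MonoidAlgebra.coeff (R := K) (M := heapOrderedForests.Elem) z P.1
  map_add' _ _ := rfl
  map_smul' _ _ := rfl

/-- The map `Θ` in degree `n`. -/
noncomputable def thetaComponent (n : ℕ) : (HOF n → K) →ₗ[K] Equiv.Perm (Fin n) → K :=
  Fintype.linearCombination K fun P : HOF n => FQSym.component K n (theta K (sp K P.1.1))

theorem component_theta (n : ℕ) (z : hHOF K) :
    FQSym.component K n (theta K (hofIncl K z)) = thetaComponent K n (hofComponent K n z) := by
  classical
  have h : FQSym.component K n ∘ₗ theta K ∘ₗ (hofIncl K : hHOF K →ₗ[K] hSP K) =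
      thetaComponent K n ∘ₗ hofComponent K n := by
    refine PosetHopf.linearMap_ext fun P => ?_
    change FQSym.component K n (theta K (hofIncl K (PosetHopf.of K P))) =
      thetaComponent K n (hofComponent K n (PosetHopf.of K P))
    have hcoeff : ∀ Q : HOF n, hofComponent K n (PosetHopf.of K P) Q = if P = Q.1 then 1 else 0 :=
      fun Q => (congrFun (congrArg DFunLike.coe (MonoidAlgebra.coeff_single (R := K) P 1))
        Q.1).trans (Finsupp.single_apply)
    rw [hofIncl_of, thetaComponent, Fintype.linearCombination_apply]
    simp only [hcoeff, ite_smul, one_smul, zero_smul]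
    by_cases hc : P.1.card = n
    · rw [Finset.sum_eq_single (⟨P, hc⟩ : HOF n)]
      · simp
      · intro Q _ hne
        exact if_neg fun h => hne (Subtype.ext h.symm)
      · simp
    · rw [Finset.sum_eq_zero, theta_sp, map_sum]
      · exact Finset.sum_eq_zero fun σ _ => FQSym.component_basis_of_ne K hc σ
      · rintro Q -
        exact if_neg fun h => hc ((congrArg (fun P => P.1.card) h).trans Q.2)
  exact LinearMap.congr_fun h z

/-- In each degree `Θ` is surjective, and there are not more heap-ordered forests than
permutations. -/
theorem thetaComponent_injective (n : ℕ) : Function.Injective (thetaComponent K n) := by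
  have hs : Function.Surjective (thetaComponent K n) := by
    intro f
    obtain ⟨y, rfl⟩ := FQSym.component_surjective K n f
    obtain ⟨z, rfl⟩ := theta_hofIncl_surjective y
    exact ⟨_, (component_theta K n z).symm⟩
  refine (LinearMap.injective_iff_surjective_of_finrank_eq_finrank
    (le_antisymm ?_ (LinearMap.finrank_le_finrank_of_surjective hs))).2 hs
  rw [Module.finrank_fintype_fun_eq_card, Module.finrank_fintype_fun_eq_card]
  exact card_HOF_le n

theorem theta_hofIncl_injective : Function.Injective fun z => theta K (hofIncl K z) := by
  intro z z' h
  refine MonoidAlgebra.coeff_injective (Finsupp.ext fun P => ?_)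
  have := (component_theta K P.1.card z).symm.trans
    ((congrArg (FQSym.component K P.1.card) h).trans (component_theta K P.1.card z'))
  exact congrFun (thetaComponent_injective K _ this) ⟨P, rfl⟩

theorem thetaBialg_comp_hofIncl_bijective :
    Function.Bijective ((thetaBialg K).comp (hofIncl K)) := by
  have h : ⇑((thetaBialg K).comp (hofIncl K)) = fun z => theta K (hofIncl K z) :=
    funext fun z => thetaBialg_apply (hofIncl K z)
  rw [h]
  exact ⟨theta_hofIncl_injective K, theta_hofIncl_surjective⟩

/-- The restriction of `Θ` to the heap-ordered forests, as an isomorphism. -/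
noncomputable def thetaEquiv : hHOF K ≃ₐc[K] FQSym K :=
  { (thetaBialg K).comp (hofIncl K),
    Equiv.ofBijective _ (thetaBialg_comp_hofIncl_bijective K) with
    map_mul' := map_mul ((thetaBialg K).comp (hofIncl K)) }

theorem thetaEquiv_apply (z : hHOF K) : thetaEquiv K z = theta K (hofIncl K z) :=
  thetaBialg_apply (hofIncl K z)

/-- The projection `Υ`: the linear combination of heap-ordered forests with the same image under
`Θ`. -/
noncomputable def upsilon : hSP K →ₐc[K] hHOF K :=
  ((thetaEquiv K).symm : FQSym K →ₐc[K] hHOF K).comp (thetaBialg K)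

theorem theta_upsilon (x : hSP K) : theta K (hofIncl K (upsilon K x)) = theta K x := by
  rw [← thetaEquiv_apply, ← thetaBialg_apply]
  exact (thetaEquiv K).toEquiv.apply_symm_apply _

theorem eq_upsilon_of_theta_eq {x : hSP K} {z : hHOF K} (h : theta K (hofIncl K z) = theta K x) :
    z = upsilon K x :=
  theta_hofIncl_injective K (h.trans (theta_upsilon K x).symm)

end Iso

end SpecialPosets

theorem theorem25 (K : Type*) [Field K] :
    -- the repeated application of the two transformations always terminates
    WellFounded (fun y x : hSP K => Rewrite K x y) ∧
    -- it stops exactly at the linear combinations of heap-ordered forests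
    (∀ x : hSP K, (∀ y, ¬ Rewrite K x y) ↔ ∃ z : hHOF K, hofIncl K z = x) ∧
    ∃ Υ : hSP K →ₐc[K] hHOF K,
      (∀ x : hSP K, Relation.ReflTransGen (Rewrite K) x (hofIncl K (Υ x))) ∧
      (∀ (x : hSP K) (z : hHOF K),
        Relation.ReflTransGen (PartialRewrite K) x (hofIncl K z) → z = Υ x) ∧
      (∀ x : hSP K, theta K (hofIncl K (Υ x)) = theta K x) ∧
      (∃ e : hHOF K ≃ₐc[K] FQSym K, ∀ z : hHOF K, e z = theta K (hofIncl K z)) ∧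
      (∀ z : hHOF K, Υ (hofIncl K z) = z) ∧
      (∀ x y : hSP K, pairing K (hofIncl K (Υ x)) (hofIncl K (Υ y)) = pairing K x y) := by
  have hred : ∀ (x : hSP K) (z : hHOF K),
      Relation.ReflTransGen (PartialRewrite K) x (hofIncl K z) → z = upsilon K x :=
    fun x z h => eq_upsilon_of_theta_eq K (theta_eq_of_reflTransGen h)
  refine ⟨rewrite_wellFounded, irreducible_iff, upsilon K, fun x => ?_, hred, theta_upsilon K,
    ⟨thetaEquiv K, thetaEquiv_apply K⟩, fun z => (eq_upsilon_of_theta_eq K rfl).symm,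
    fun x y => ?_⟩
  · obtain ⟨z, hz⟩ := exists_reduction x
    rwa [← hred x z (Relation.ReflTransGen.mono (fun _ _ => Rewrite.partialRewrite) _ _ hz)]
  · rw [pairing_eq_invPairing, pairing_eq_invPairing, theta_upsilon, theta_upsilon]
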